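/- Let $y_j=\theta_j+\sigma\xi_j$, $j=1,\dots,d$, where $\theta\in\mathbb R^d$ is unknown, $\sigma>0$ and $\xi_1,\dots,\xi_d$ are i.i.d. standard normal, and let $\mathbf P_\theta$ be the law of $y=(y_1,\dots,y_d)$. Let $\|\theta\|_0$ be the number of non-zero components of $\theta$, $\|\theta\|_q=(\sum_{i}|\theta_i|^q)^{1/q}$ for $q>0$, $B_0(s)=\{\theta\in\mathbb R^d:\|\theta\|_0\le s\}$, $B_q(r)=\{\theta\in\mathbb R^d:\|\theta\|_q\le r\}$, and $\Theta_{q,u}(\delta)=\{\theta\in B_q(u):\|\theta\|_2\ge\delta\}$ for $q\ge0$. For testing $\theta=0$ against $\theta\in\Theta_{q,u}(\delta)$ define the minimax risk $$\mathcal R_{q,u}(\delta)=\inf_\Delta\Big\{\mathbf P_0(\Delta=1)+\sup_{\theta\in\Theta_{q,u}(\delta)}\mathbf P_\theta(\Delta=0)\Big\},$$ where the infimum is over all $\{0,1\}$-valued statistics $\Delta=\Delta(y)$ and the supremum over an empty set is $0$. 1. For integers $1\le s\le d$ and $\sigma>0$ put $\psi_\sigma^{\sqrt Q}(s,d)=\sigma^2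 s\log(1+d/s^2)$ if $s<\sqrt d$ and $\psi_\sigma^{\sqrt Q}(s,d)=\sigma^2\sqrt d$ if $s\ge\sqrt d$. Then $\lambda=\big(\psi_\sigma^{\sqrt Q}(s,d)\big)^{1/2}$ is the non-asymptotic minimax rate of testing on $\Theta_{0,s}$, that is, $\lambda>0$ and: (i) for every $\varepsilon\in(0,1)$ there is $A_\varepsilon>0$ such that $\mathcal R_{0,s}(A\lambda)\le\varepsilon$ for all $A>A_\varepsilon$; (ii) for every $\varepsilon\in(0,1)$ there is $a_\varepsilon>0$ such that $\mathcal R_{0,s}(A\lambda)\ge1-\varepsilon$ for all $0<A<a_\varepsilon$. Here $A_\varepsilon$ and $a_\varepsilon$ depend only on $\varepsilon$, and not on $s,d,\sigma$. 2. Let $0<q<2$. For an integer $d\ge1$ and $r,\sigma>0$ let $m\in\{0,1,2,\dots\}\cup\{\infty\}$ be the largest $s$ such that $\sigma^2\log(1+d/t^2)\le r^2t^{-2/q}$ for all integers $1\le t\le s$ ($m=0$ if this fails for $t=1$, and $m=\infty$ if it holds for all $t\ge1$). Put $$\psi_{\sigma,q}^{\sqrt Q}(r,d)=\begin{cases}\sigma^2\sqrt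 d & \text{if } m>\sqrt d,\\ \sigma^2m\log(1+d/m^2) & \text{if } 1\le m\le\sqrt d,\\ r^2 & \text{if } m=0.\end{cases}$$ Then $\lambda=\big(\psi_{\sigma,q}^{\sqrt Q}(r,d)\big)^{1/2}$ is the minimax rate of testing on $\Theta_{q,r}$: $\lambda>0$, and (i) and (ii) hold with $\mathcal R_{q,r}$ in place of $\mathcal R_{0,s}$, where $A_\varepsilon$ and $a_\varepsilon$ depend only on $\varepsilon$ and $q$, and not on $d,r,\sigma$. -/

import Mathlib

open MeasureTheory ProbabilityTheory
open scoped ENNReal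

noncomputable section

namespace SparseTesting

/-- The law of the observations `y_j = θ_j + σ ξ_j`, `j = 1, …, d`, with `ξ_j` i.i.d. standard
normal. -/
def obsLaw {d : ℕ} (σ : ℝ) (θ : Fin d → ℝ) : Measure (Fin d → ℝ) :=
  (Measure.pi fun _ : Fin d => gaussianReal 0 1).map fun ξ j => θ j + σ * ξ j

/-- The number `‖θ‖₀` of non-zero components. -/
def l0 {d : ℕ} (θ : Fin d → ℝ) : ℕ :=
  Set.ncard {j | θ j ≠ 0}

/-- `‖θ‖_q = (∑ |θ_i|^q)^(1/q)` for `q > 0`. -/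
def lq {d : ℕ} (q : ℝ) (θ : Fin d → ℝ) : ℝ :=
  (∑ i, |θ i| ^ q) ^ (1 / q)

/-- The Euclidean norm `‖θ‖₂ = √(∑ θ_i²)`. -/
def l2 {d : ℕ} (θ : Fin d → ℝ) : ℝ :=
  √(∑ i, θ i ^ 2)

/-- The alternative `{θ ∈ B_0(s) : ‖θ‖₂ ≥ δ}`. -/
def sparseAlt (d s : ℕ) (δ : ℝ) : Set (Fin d → ℝ) :=
  {θ | l0 θ ≤ s ∧ δ ≤ l2 θ}

/-- The alternative `{θ ∈ B_q(r) : ‖θ‖₂ ≥ δ}`, for `q > 0`. -/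
def ballAlt (d : ℕ) (q r δ : ℝ) : Set (Fin d → ℝ) :=
  {θ | lq q θ ≤ r ∧ δ ≤ l2 θ}

/-- The risk of the `{0,1}`-valued test `Δ` of `θ = 0` against `θ ∈ Θ`: first type error plus
maximum second type error (the latter is `0` if `Θ` is empty). -/
def testRisk {d : ℕ} (σ : ℝ) (Θ : Set (Fin d → ℝ)) (Δ : (Fin d → ℝ) → Fin 2) : ℝ≥0∞ :=
  obsLaw σ 0 {y | Δ y = 1} + ⨆ θ ∈ Θ, obsLaw σ θ {y | Δ y = 0}

/-- The minimax risk of testing `θ = 0` against `θ ∈ Θ`: infimum over all `{0,1}`-valued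
statistics. -/
def minimaxRisk {d : ℕ} (σ : ℝ) (Θ : Set (Fin d → ℝ)) : ℝ≥0∞ :=
  ⨅ (Δ : (Fin d → ℝ) → Fin 2) (_ : Measurable Δ), testRisk σ Θ Δ

/-- The rate `ψ` on `B_0(s)`. -/
def psiSparse (d s : ℕ) (σ : ℝ) : ℝ :=
  if (s : ℝ) < √d then σ ^ 2 * s * Real.log (1 + d / (s : ℝ) ^ 2) else σ ^ 2 * √d

/-- The effective sparsity `m` of the ball `B_q(r)`: the largest `s` such that
`σ² log(1 + d/t²) ≤ r² t^(-2/q)` for all integers `1 ≤ t ≤ s`; it is `0` if the inequality fails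
at `t = 1`, and `⊤` if the inequality never fails. For `q ≤ 1` the inequality at `s` implies the
inequality at all `1 ≤ t ≤ s`, so that `m` is the largest `s ≥ 1` where it holds. -/
def effSparsity (d : ℕ) (q r σ : ℝ) : ℕ∞ :=
  ⨆ s ∈ {s : ℕ | 1 ≤ s ∧ ∀ t : ℕ, 1 ≤ t → t ≤ s →
    σ ^ 2 * Real.log (1 + d / (t : ℝ) ^ 2) ≤ r ^ 2 * (t : ℝ) ^ (-2 / q)}, (s : ℕ∞)

/-- The rate `ψ` on `B_q(r)`: dense zone `m > √d` (including `m = ⊤`), sparse zone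
`1 ≤ m ≤ √d`, degenerate zone `m = 0`. -/
def psiBall (d : ℕ) (q r σ : ℝ) : ℝ :=
  let m := effSparsity d q r σ
  if m = ⊤ ∨ √d < (m.toNat : ℝ) then σ ^ 2 * √d
  else if 1 ≤ m then σ ^ 2 * m.toNat * Real.log (1 + d / (m.toNat : ℝ) ^ 2)
  else r ^ 2

end SparseTesting

end

/-! Lower bounds. By the second-moment method, a finite family of means `σ h i` cannot be told from
`0` once its uniform mixture has a likelihood ratio with second moment at most `1 + ε²`
(`le_minimaxRisk_of_sum_exp_le`). For Gaussian shifts that moment is the average of `exp ⟨h i, h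
i'⟩`. The prior places `s` equal spikes, one in each of `s` blocks of about `d / s` coordinates.
Matches between two independent draws are then independent from block to block, so the moment is an
exact `s`-th power, and it is close to `1` when the squared spikes are a small multiple of `σ² log(1
+ d/s²)` (`le_minimaxRisk_of_card_eq`). In the dense zones `s` is taken to be `⌊√d⌋`.

Upper bounds. The test rejects when the sum of the centred `(|y_j|/σ - t)_+²` is large, with `t = 0`
in the dense zone and `t = 4√L`, `L = log(1 + d/s²)`, in the sparse zone; Chebyshev's inequality
bounds both errors (`minimaxRisk_le_of_variance_le`). Thresholding leaves a null coordinate with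
variance of order `exp(-L)`, and `d exp(-L) ≤ s²`, so the noise level is `s L`. By convexity no
coordinate lowers the expectation, and one with `|θ_j|/σ > 2t` raises it by at least `(θ_j/σ)²/8`.
The class enters only through the energy of the remaining coordinates, which is of order `s L`.

For `B_q(r)` the effective sparsity `m` plays the role of `s`: the inequality at `m` puts the spikes
in the ball, and its failure at `m + 1` bounds the energy of small coordinates. If `m = 0`, one
spike of length `A r` gives the lower bound, and for `A > 1` the alternative is empty. -/

namespace SparseTesting

/-! ### Likelihood ratios of Gaussian shifts. -/

/-- The standard Gaussian law on `ℝ^d`. -/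
noncomputable abbrev stdLaw (d : ℕ) : Measure (Fin d → ℝ) :=
  Measure.pi fun _ : Fin d => gaussianReal 0 1

/-- The likelihood ratio of `N(h, I)` with respect to `N(0, I)`. -/
noncomputable def likelihood {d : ℕ} (h z : Fin d → ℝ) : ℝ :=
  ∏ j, Real.exp (h j * z j - h j ^ 2 / 2)

lemma likelihood_nonneg {d : ℕ} (h z : Fin d → ℝ) : 0 ≤ likelihood h z :=
  Finset.prod_nonneg fun _ _ => (Real.exp_pos _).le

lemma integrable_exp_affine (a b : ℝ) :
    Integrable (fun x => Real.exp (a * x - b)) (gaussianReal 0 1) := by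
  simp_rw [Real.exp_sub, div_eq_mul_inv]
  exact (integrable_exp_mul_gaussianReal a).mul_const _

lemma integral_exp_affine (a b : ℝ) :
    ∫ x, Real.exp (a * x - b) ∂gaussianReal 0 1 = Real.exp (a ^ 2 / 2 - b) := by
  have h := congrFun (mgf_fun_id_gaussianReal (μ := 0) (v := 1)) a
  simp only [mgf, zero_mul, zero_add, NNReal.coe_one, one_mul] at h
  simp_rw [Real.exp_sub, div_eq_mul_inv (Real.exp _)]
  rw [integral_mul_const, h]

lemma integrable_likelihood {d : ℕ} (h : Fin d → ℝ) :
    Integrable (likelihood h) (stdLaw d) :=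
  Integrable.fintype_prod (f := fun j x => Real.exp (h j * x - h j ^ 2 / 2))
    fun _ => integrable_exp_affine _ _

lemma integral_likelihood {d : ℕ} (h : Fin d → ℝ) :
    ∫ z, likelihood h z ∂stdLaw d = 1 := by
  unfold likelihood
  rw [integral_fintype_prod_eq_prod (f := fun j x => Real.exp (h j * x - h j ^ 2 / 2))]
  simp [integral_exp_affine]

lemma likelihood_mul {d : ℕ} (h h' z : Fin d → ℝ) :
    likelihood h z * likelihood h' z =
      ∏ j, Real.exp ((h j + h' j) * z j - (h j ^ 2 / 2 + h' j ^ 2 / 2)) := by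
  rw [likelihood, likelihood, ← Finset.prod_mul_distrib]
  refine Finset.prod_congr rfl fun j _ => ?_
  rw [← Real.exp_add]
  ring_nf

lemma integrable_likelihood_mul {d : ℕ} (h h' : Fin d → ℝ) :
    Integrable (fun z => likelihood h z * likelihood h' z) (stdLaw d) := by
  simp_rw [likelihood_mul]
  exact Integrable.fintype_prod
    (f := fun j x => Real.exp ((h j + h' j) * x - (h j ^ 2 / 2 + h' j ^ 2 / 2)))
    fun _ => integrable_exp_affine _ _

lemma integral_likelihood_mul {d : ℕ} (h h' : Fin d → ℝ) :
    ∫ z, likelihood h z * likelihood h' z ∂stdLaw d = Real.exp (∑ j, h j * h' j) := by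
  simp_rw [likelihood_mul]
  rw [integral_fintype_prod_eq_prod
    (f := fun j x => Real.exp ((h j + h' j) * x - (h j ^ 2 / 2 + h' j ^ 2 / 2))), Real.exp_sum]
  refine Finset.prod_congr rfl fun j _ => ?_
  rw [integral_exp_affine]
  ring_nf

lemma gaussianReal_apply_eq_integral_exp (h : ℝ) {s : Set ℝ} (hs : MeasurableSet s) :
    gaussianReal h 1 s =
      ENNReal.ofReal (∫ x in s, Real.exp (h * x - h ^ 2 / 2) ∂gaussianReal 0 1) := by
  rw [gaussianReal_apply_eq_integral h one_ne_zero, ← integral_indicator hs,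
    ← integral_indicator hs, integral_gaussianReal_eq_integral_smul one_ne_zero]
  congr 2
  ext x
  by_cases hx : x ∈ s
  · simp only [Set.indicator_of_mem hx, gaussianPDFReal, smul_eq_mul, mul_assoc, ← Real.exp_add]
    congr 2
    simp
    ring
  · simp [hx]

lemma pi_gaussianReal_eq_withDensity {d : ℕ} (h : Fin d → ℝ) :
    (Measure.pi fun j => gaussianReal (h j) 1) =
      (stdLaw d).withDensity fun z => ENNReal.ofReal (likelihood h z) := by
  refine Measure.pi_eq fun s hs => ?_
  rw [withDensity_apply _ (MeasurableSet.univ_pi hs),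
    ← ofReal_integral_eq_lintegral_ofReal (integrable_likelihood h).restrict
      (ae_of_all _ fun z => likelihood_nonneg h z), Measure.restrict_pi_pi]
  unfold likelihood
  rw [integral_fintype_prod_eq_prod (f := fun j x => Real.exp (h j * x - h j ^ 2 / 2)),
    ENNReal.ofReal_prod_of_nonneg
      fun j _ => integral_nonneg fun _ => (Real.exp_pos _).le]
  exact Finset.prod_congr rfl fun j _ => (gaussianReal_apply_eq_integral_exp (h j) (hs j)).symm

/-- The observations, in units of `σ`, are a shifted standard Gaussian vector. -/
lemma obsLaw_apply {d : ℕ} {σ : ℝ} (hσ : 0 < σ) (θ : Fin d → ℝ) {B : Set (Fin d → ℝ)}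
    (hB : MeasurableSet B) :
    obsLaw σ θ B = stdLaw d {ξ | (fun j => σ * (θ j / σ + ξ j)) ∈ B} := by
  rw [obsLaw, Measure.map_apply (by fun_prop) hB]
  congr 1
  ext ξ
  simp only [Set.mem_preimage, Set.mem_ofPred_eq]
  have : (fun j => θ j + σ * ξ j) = fun j => σ * (θ j / σ + ξ j) := by
    ext j
    field_simp
  rw [this]

lemma obsLaw_apply_eq_integral_likelihood {d : ℕ} {σ : ℝ} (hσ : 0 < σ) (h : Fin d → ℝ)
    {B : Set (Fin d → ℝ)} (hB : MeasurableSet B) :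
    obsLaw σ (fun j => σ * h j) B =
      ENNReal.ofReal (∫ z in {z | (fun j => σ * z j) ∈ B}, likelihood h z ∂stdLaw d) := by
  have hC : MeasurableSet {z : Fin d → ℝ | (fun j => σ * z j) ∈ B} :=
    (show Measurable fun z : Fin d → ℝ => fun j => σ * z j by fun_prop) hB
  have hmap : (stdLaw d).map (fun ξ j => h j + ξ j) = Measure.pi fun j => gaussianReal (h j) 1 := by
    rw [stdLaw, Measure.pi_map_pi (f := fun j x => h j + x) fun j => by fun_prop]
    simp [gaussianReal_map_const_add]
  rw [obsLaw_apply hσ _ hB, ofReal_integral_eq_lintegral_ofReal (integrable_likelihood h).restrict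
      (ae_of_all _ fun z => likelihood_nonneg h z), ← withDensity_apply _ hC,
    ← pi_gaussianReal_eq_withDensity, ← hmap, Measure.map_apply (by fun_prop) hC]
  simp [hσ.ne']

/-! ### The second-moment lower bound. -/

/-- Lower bound on the minimax risk by the second moment of the likelihood ratio of a uniform
prior on finitely many alternatives. -/
lemma le_minimaxRisk_of_sum_exp_le {d : ℕ} {σ ε : ℝ} (hσ : 0 < σ) (hε : 0 < ε)
    {Θ : Set (Fin d → ℝ)} {ι : Type*} [Fintype ι] [Nonempty ι] (h : ι → Fin d → ℝ)
    (hΘ : ∀ i, (fun j => σ * h i j) ∈ Θ)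
    (hsum : ∑ i, ∑ i', Real.exp (∑ j, h i j * h i' j) ≤ (1 + ε ^ 2) * (Fintype.card ι : ℝ) ^ 2) :
    ENNReal.ofReal (1 - ε) ≤ minimaxRisk σ Θ := by
  refine le_iInf₂ fun Δ hΔ => ?_
  have h0 : MeasurableSet {y | Δ y = 0} := hΔ (measurableSet_singleton 0)
  have h1 : MeasurableSet {y | Δ y = 1} := hΔ (measurableSet_singleton 1)
  set B : Set (Fin d → ℝ) := {z | (fun j => σ * z j) ∈ {y | Δ y = 0}} with hBdef
  have hB : MeasurableSet B :=
    (show Measurable fun z : Fin d → ℝ => fun j => σ * z j by fun_prop) h0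
  have hN : (0 : ℝ) < Fintype.card ι := by exact_mod_cast Fintype.card_pos
  set N : ℝ := (Fintype.card ι : ℝ) with hNdef
  let L : (Fin d → ℝ) → ℝ := fun z => N⁻¹ * ∑ i, likelihood (h i) z
  have hLi : Integrable L (stdLaw d) :=
    (integrable_finsetSum _ fun i _ => integrable_likelihood (h i)).const_mul _
  have hL1 : ∫ z, L z ∂stdLaw d = 1 := by
    simp only [L]
    rw [integral_const_mul, integral_finsetSum _ fun i _ => integrable_likelihood (h i)]
    simp [integral_likelihood, ← hNdef, hN.ne']
  have hLsq : ∀ z, L z ^ 2 = (N ^ 2)⁻¹ * ∑ i, ∑ i', likelihood (h i) z * likelihood (h i') z := by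
    intro z
    simp only [L, mul_pow, inv_pow, sq (∑ i, likelihood (h i) z), Finset.sum_mul_sum]
  have hL2i : Integrable (fun z => L z ^ 2) (stdLaw d) := by
    simp_rw [hLsq]
    exact (integrable_finsetSum _ fun i _ => integrable_finsetSum _ fun i' _ =>
      integrable_likelihood_mul (h i) (h i')).const_mul _
  have hL2 : ∫ z, L z ^ 2 ∂stdLaw d ≤ 1 + ε ^ 2 := by
    simp_rw [hLsq]
    rw [integral_const_mul, integral_finsetSum _ fun i _ => integrable_finsetSum _ fun i' _ =>
      integrable_likelihood_mul (h i) (h i')]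
    simp_rw [integral_finsetSum _ fun i' _ => integrable_likelihood_mul (h _) (h i'),
      integral_likelihood_mul]
    rw [inv_mul_le_iff₀ (by positivity)]
    linarith
  have hli : Integrable (fun z => 1 - 2 * L z) (stdLaw d) :=
    (integrable_const _).sub (hLi.const_mul 2)
  have hchi : ∫ z, (1 - L z) ^ 2 ∂stdLaw d ≤ ε ^ 2 := by
    have : ∀ z, (1 - L z) ^ 2 = 1 - 2 * L z + L z ^ 2 := fun z => by ring
    simp_rw [this]
    rw [integral_add hli hL2i,
      integral_sub (integrable_const _) (hLi.const_mul 2), integral_const_mul, hL1]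
    simp
    linarith
  have hXi : Integrable (fun z => 1 - L z) (stdLaw d) := (integrable_const _).sub hLi
  have hX2i : Integrable (fun z => (1 - L z) ^ 2) (stdLaw d) := by
    have : ∀ z, (1 - L z) ^ 2 = 1 - 2 * L z + L z ^ 2 := fun z => by ring
    simp_rw [this]
    exact hli.add hL2i
  have habs : ∫ z in B, (1 - L z) ∂stdLaw d ≤ ε := by
    calc ∫ z in B, (1 - L z) ∂stdLaw d ≤ ∫ z in B, |1 - L z| ∂stdLaw d :=
          integral_mono hXi.restrict hXi.abs.restrict fun z => le_abs_self _
      _ ≤ ∫ z, |1 - L z| ∂stdLaw d :=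
          setIntegral_le_integral hXi.abs (ae_of_all _ fun z => abs_nonneg _)
      _ ≤ ∫ z, ((2 * ε)⁻¹ * (1 - L z) ^ 2 + ε / 2) ∂stdLaw d := by
          -- `|x| ≤ x²/(2ε) + ε/2` turns the chi-square bound `ε²` into the `L¹` bound `ε`, in place
          -- of Cauchy–Schwarz.
          refine integral_mono hXi.abs ((hX2i.const_mul _).add (integrable_const _)) fun z => ?_
          have : (2 * ε)⁻¹ * (1 - L z) ^ 2 + ε / 2 - |1 - L z| =
              (2 * ε)⁻¹ * (|1 - L z| - ε) ^ 2 := by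
            rw [← sq_abs (1 - L z)]
            field_simp
            ring
          have h2 : 0 ≤ (2 * ε)⁻¹ * (|1 - L z| - ε) ^ 2 := by positivity
          simp only
          linarith
      _ ≤ ε := by
          rw [integral_add (hX2i.const_mul _) (integrable_const _), integral_const_mul]
          have : (2 * ε)⁻¹ * ∫ z, (1 - L z) ^ 2 ∂stdLaw d ≤ ε / 2 := by
            rw [inv_mul_le_iff₀ (by positivity)]
            nlinarith
          rw [integral_const, probReal_univ, one_smul]
          linarith
  -- The worst alternative is at least as bad as the prior average.
  obtain ⟨i, hi⟩ : ∃ i, ∫ z in B, L z ∂stdLaw d ≤ ∫ z in B, likelihood (h i) z ∂stdLaw d := by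
    by_contra! hcon
    have := Finset.sum_lt_sum_of_nonempty (s := Finset.univ) Finset.univ_nonempty
      fun i _ => hcon i
    simp only [L] at this
    rw [integral_const_mul,
      integral_finsetSum _ fun i _ => (integrable_likelihood (h i)).restrict] at this
    simp [← hNdef, hN.ne'] at this
  have hP0 : obsLaw σ 0 {y | Δ y = 1} = ENNReal.ofReal (1 - (stdLaw d).real B) := by
    rw [obsLaw_apply hσ _ h1, ← probReal_compl_eq_one_sub hB, ofReal_measureReal]
    congr 1
    ext ξ
    simp only [Pi.zero_apply, zero_div, zero_add, Set.mem_ofPred_eq, hBdef, Set.mem_compl_iff]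
    generalize Δ _ = b
    fin_cases b <;> simp
  have hPi : ENNReal.ofReal (∫ z in B, L z ∂stdLaw d) ≤ ⨆ θ ∈ Θ, obsLaw σ θ {y | Δ y = 0} := by
    refine le_trans ?_ (le_iSup₂_of_le _ (hΘ i) le_rfl)
    rw [obsLaw_apply_eq_integral_likelihood hσ _ h0]
    exact ENNReal.ofReal_le_ofReal hi
  rw [testRisk, hP0]
  refine le_trans ?_ (add_le_add le_rfl hPi)
  rw [← ENNReal.ofReal_add (by simp [measureReal_le_one])
    (integral_nonneg fun z => mul_nonneg (by positivity)
      (Finset.sum_nonneg fun i _ => likelihood_nonneg _ _))]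
  refine ENNReal.ofReal_le_ofReal ?_
  rw [integral_sub (integrable_const _) hLi.restrict] at habs
  simp at habs
  linarith

/-! ### The block prior. -/

lemma sum_prod_ite_eq {s b : ℕ} (f : Fin s → Fin b) (c : ℝ) :
    ∑ f' : Fin s → Fin b, ∏ k, (if f k = f' k then c else 1) = (b - 1 + c) ^ s := by
  -- The choices of `f'` in different blocks are independent, and in each block exactly one of the
  -- `b` values matches `f`.
  rw [← Fintype.prod_sum (f := fun k i => if f k = i then c else 1)]
  have : ∀ k, ∑ i, (if f k = i then c else 1) = b - 1 + c := by
    intro k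
    have : ∀ i, (if f k = i then c else 1) = (if f k = i then c - 1 else 0) + 1 := by
      intro i
      split_ifs <;> ring
    simp_rw [this, Finset.sum_add_distrib]
    simp
    ring
  simp [this]

/-- The second moment bound for the uniform prior on supports that meet each of `s` blocks of size
`b` in exactly one point. -/
lemma one_add_div_pow_le_exp {s b d : ℕ} {a v : ℝ} (hs : 1 ≤ s) (hb : d ≤ 2 * (s * b))
    (hd : 1 ≤ d) (ha0 : 0 ≤ a) (ha : a ≤ 1) (hv : v ≤ a * Real.log (1 + d / (s : ℝ) ^ 2)) :
    ((b : ℝ) - 1 + Real.exp v) ^ s ≤ Real.exp (2 * a) * (b : ℝ) ^ s := by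
  have hs' : (0 : ℝ) < s := by exact_mod_cast hs
  have hd' : (0 : ℝ) < d := by exact_mod_cast hd
  have hb' : (d : ℝ) ≤ 2 * (s * b) := by exact_mod_cast hb
  have hb0 : (0 : ℝ) < b := by
    by_contra h
    nlinarith
  -- Bernoulli's inequality `(1 + x)^a ≤ 1 + a x` for `0 ≤ a ≤ 1`.
  have hexp : Real.exp v ≤ 1 + a * (d / (s : ℝ) ^ 2) := by
    refine le_trans (Real.exp_le_exp.2 hv) ?_
    rw [mul_comm, Real.exp_mul, Real.exp_log (by positivity)]
    exact rpow_one_add_le_one_add_mul_self (by linarith [show 0 ≤ d / (s : ℝ) ^ 2 by positivity])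
      ha0 ha
  have hle : a * (d / (s : ℝ) ^ 2) ≤ 2 * a / s * b := by
    have : 2 * a / s * b - a * (d / (s : ℝ) ^ 2) = a * (2 * (s * b) - d) / s ^ 2 := by
      field_simp
    have h2 : 0 ≤ a * (2 * (s * b) - d) / (s : ℝ) ^ 2 :=
      div_nonneg (mul_nonneg ha0 (by linarith)) (by positivity)
    linarith
  have hb1 : (1 : ℝ) ≤ b := by exact_mod_cast (show 0 < b by exact_mod_cast hb0)
  calc ((b : ℝ) - 1 + Real.exp v) ^ s ≤ (b * Real.exp (2 * a / s)) ^ s := by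
        refine pow_le_pow_left₀ (by linarith [Real.exp_pos v]) ?_ s
        have := Real.add_one_le_exp (2 * a / s)
        nlinarith
    _ = Real.exp (2 * a) * (b : ℝ) ^ s := by
        rw [mul_pow, ← Real.exp_nat_mul, mul_comm]
        congr 2
        field_simp

/-- Testing against vectors with `s ≤ √d` equal non-zero entries is impossible when the entries are
small compared with `σ √(log (1 + d / s²))`. -/
lemma le_minimaxRisk_of_card_eq {d s : ℕ} {σ τ ε a : ℝ} (hs : 1 ≤ s) (hsd : s ^ 2 ≤ d) (hσ : 0 < σ)
    (hε : 0 < ε) (ha0 : 0 ≤ a) (ha : a ≤ 1) (haε : Real.exp (2 * a) ≤ 1 + ε ^ 2)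
    (hτ : τ ^ 2 ≤ a * (σ ^ 2 * Real.log (1 + d / (s : ℝ) ^ 2)))
    {Θ : Set (Fin d → ℝ)}
    (hΘ : ∀ S : Finset (Fin d), S.card = s → (fun j => if j ∈ S then τ else 0) ∈ Θ) :
    ENNReal.ofReal (1 - ε) ≤ minimaxRisk σ Θ := by
  have hsd' : s ≤ d := le_trans (by nlinarith) hsd
  -- Floor division: the last `d % s` coordinates carry no spike, and `s * b` still covers at least
  -- half of `d`.
  set b := d / s with hb
  have hb1 : 1 ≤ b := (Nat.one_le_div_iff hs).2 hsd'
  have hsb : s * b ≤ d := Nat.mul_div_le d s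
  have hdb : d ≤ 2 * (s * b) := by
    have h1 : s * b + d % s = d := Nat.div_add_mod d s
    have h2 : d % s < s := Nat.mod_lt _ hs
    nlinarith
  have : NeZero b := ⟨by omega⟩
  let e : Fin s × Fin b → Fin d := fun p => Fin.castLE hsb (finProdFinEquiv p)
  have he : Function.Injective e :=
    (Fin.castLE_injective hsb).comp finProdFinEquiv.injective
  have hinj : ∀ f : Fin s → Fin b, Function.Injective fun k => e (k, f k) := fun f k k' hkk =>
    (Prod.ext_iff.1 (he hkk)).1
  let S : (Fin s → Fin b) → Finset (Fin d) := fun f => Finset.univ.image fun k => e (k, f k)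
  have hS : ∀ f, (S f).card = s := fun f => by
    simp [S, Finset.card_image_of_injective _ (hinj f)]
  refine le_minimaxRisk_of_sum_exp_le hσ hε (ι := Fin s → Fin b)
    (fun f j => if j ∈ S f then τ / σ else 0) (fun f => ?_) ?_
  · have := hΘ (S f) (hS f)
    convert this using 2 with j
    split_ifs
    · field_simp
    · simp
  · have hv : (τ / σ) ^ 2 ≤ a * Real.log (1 + d / (s : ℝ) ^ 2) := by
      rw [div_pow, div_le_iff₀ (by positivity)]
      linarith
    have hinner : ∀ f f' : Fin s → Fin b,
        ∑ j, (if j ∈ S f then τ / σ else 0) * (if j ∈ S f' then τ / σ else 0) =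
          ∑ k, if f k = f' k then (τ / σ) ^ 2 else 0 := by
      intro f f'
      have h1 : ∀ j, (if j ∈ S f then τ / σ else 0) * (if j ∈ S f' then τ / σ else 0) =
          if j ∈ S f then (if j ∈ S f' then (τ / σ) ^ 2 else 0) else 0 := by
        intro j
        split_ifs <;> ring
      simp_rw [h1]
      rw [Finset.sum_ite_mem, Finset.univ_inter, Finset.sum_image fun k _ k' _ h => hinj f h]
      refine Finset.sum_congr rfl fun k _ => ?_
      have : e (k, f k) ∈ S f' ↔ f k = f' k := by
        simp only [S, Finset.mem_image, Finset.mem_univ, true_and]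
        constructor
        · rintro ⟨k', hk'⟩
          have := he hk'
          simp only [Prod.mk.injEq] at this
          rw [← this.2, this.1]
        · intro h
          exact ⟨k, by rw [h]⟩
      simp only [this]
    simp_rw [hinner, Real.exp_sum]
    have h2 : ∀ f f' : Fin s → Fin b, ∏ k, Real.exp (if f k = f' k then (τ / σ) ^ 2 else 0) =
        ∏ k, if f k = f' k then Real.exp ((τ / σ) ^ 2) else 1 := fun f f' =>
      Finset.prod_congr rfl fun k _ => by split_ifs <;> simp
    simp_rw [h2, sum_prod_ite_eq]
    simp only [Finset.sum_const, Finset.card_univ, Fintype.card_pi, Fintype.card_fin,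
      Finset.prod_const, nsmul_eq_mul, Nat.cast_pow]
    have h3 := one_add_div_pow_le_exp hs hdb (by omega) ha0 ha hv
    have h4 : (0 : ℝ) ≤ (b : ℝ) ^ s := by positivity
    calc (b : ℝ) ^ s * ((b : ℝ) - 1 + Real.exp ((τ / σ) ^ 2)) ^ s
        ≤ (b : ℝ) ^ s * (Real.exp (2 * a) * (b : ℝ) ^ s) := by gcongr
      _ ≤ (b : ℝ) ^ s * ((1 + ε ^ 2) * (b : ℝ) ^ s) := by gcongr
      _ = _ := by ring

lemma exists_exp_two_mul_le {ε : ℝ} (hε : 0 < ε) :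
    ∃ a : ℝ, 0 < a ∧ a ≤ 1 ∧ Real.exp (2 * a) ≤ 1 + ε ^ 2 := by
  have h : 0 < Real.log (1 + ε ^ 2) := Real.log_pos (by nlinarith)
  refine ⟨min 1 (Real.log (1 + ε ^ 2) / 2), by positivity, min_le_left _ _, ?_⟩
  rw [← Real.le_log_iff_exp_le (by positivity)]
  linarith [min_le_right 1 (Real.log (1 + ε ^ 2) / 2)]

/-! ### Norms of equal-entry vectors and the size of the logarithm. -/

lemma l2_sq {d : ℕ} (θ : Fin d → ℝ) : l2 θ ^ 2 = ∑ i, θ i ^ 2 :=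
  Real.sq_sqrt (Finset.sum_nonneg fun _ _ => sq_nonneg _)

lemma le_l2_of_sq_le {d : ℕ} {θ : Fin d → ℝ} {x : ℝ} (h : x ^ 2 ≤ ∑ i, θ i ^ 2) : x ≤ l2 θ :=
  Real.le_sqrt_of_sq_le h

lemma sum_sq_ite {d : ℕ} (S : Finset (Fin d)) (τ : ℝ) :
    ∑ j, (if j ∈ S then τ else 0) ^ 2 = S.card * τ ^ 2 := by
  simp [ite_pow]

lemma l0_ite_le {d : ℕ} (S : Finset (Fin d)) (τ : ℝ) :
    l0 (fun j => if j ∈ S then τ else 0) ≤ S.card := by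
  rw [l0, ← Set.ncard_coe_finset]
  refine Set.ncard_le_ncard ?_ S.finite_toSet
  intro j hj
  by_contra h
  exact hj (if_neg (by simpa using h))

lemma lq_ite {d : ℕ} {q τ : ℝ} (hq : 0 < q) (hτ : 0 ≤ τ) (S : Finset (Fin d)) :
    lq q (fun j => if j ∈ S then τ else 0) = (S.card : ℝ) ^ (1 / q) * τ := by
  have : ∀ j, |if j ∈ S then τ else 0| ^ q = if j ∈ S then τ ^ q else 0 := by
    intro j
    split_ifs
    · rw [abs_of_nonneg hτ]
    · simp [Real.zero_rpow hq.ne']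
  simp only [lq, this]
  rw [Finset.sum_ite_mem, Finset.univ_inter, Finset.sum_const, nsmul_eq_mul,
    Real.mul_rpow (by positivity) (by positivity), ← Real.rpow_mul hτ, mul_one_div_cancel hq.ne',
    Real.rpow_one]

lemma half_le_log_one_add {x : ℝ} (hx : 1 ≤ x) : 1 / 2 ≤ Real.log (1 + x) := by
  have h1 : Real.log 2 ≤ Real.log (1 + x) := Real.log_le_log (by norm_num) (by linarith)
  linarith [Real.log_two_gt_d9]

lemma half_le_log_of_sq_le {d s : ℕ} (hs : 1 ≤ s) (hsd : s ^ 2 ≤ d) :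
    1 / 2 ≤ Real.log (1 + d / (s : ℝ) ^ 2) := by
  refine half_le_log_one_add ?_
  have : (0 : ℝ) < s := by exact_mod_cast hs
  rw [one_le_div (by positivity)]
  exact_mod_cast hsd

/-! ### Gaussian moments. -/

lemma integrable_pow_four_mul_exp :
    Integrable (fun x : ℝ => x ^ 4 * Real.exp (x ^ 2 / 4)) (gaussianReal 0 1) := by
  rw [gaussianReal_of_var_ne_zero 0 one_ne_zero,
    integrable_withDensity_iff_integrable_smul' (measurable_gaussianPDF 0 1)
      (ae_of_all _ fun _ => gaussianPDF_lt_top)]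
  have h := (integrable_rpow_mul_exp_neg_mul_sq (b := 1 / 4) (by norm_num) (s := 4)
    (by norm_num)).const_mul (√(2 * Real.pi * 1))⁻¹
  refine h.congr (ae_of_all _ fun x => ?_)
  simp only [toReal_gaussianPDF, gaussianPDFReal, smul_eq_mul, NNReal.coe_one, sub_zero, mul_one]
  have h4 : x ^ (4 : ℝ) = x ^ 4 := by exact_mod_cast Real.rpow_natCast x 4
  rw [h4, mul_assoc, mul_left_comm (Real.exp _), ← Real.exp_add]
  ring_nf

/-- A moment of the standard Gaussian law. -/
noncomputable def gaussMoment : ℝ := ∫ x, x ^ 4 * Real.exp (x ^ 2 / 4) ∂gaussianReal 0 1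

lemma gaussMoment_nonneg : 0 ≤ gaussMoment :=
  integral_nonneg fun x => by positivity

lemma pow_four_le (x : ℝ) : x ^ 4 ≤ x ^ 4 * Real.exp (x ^ 2 / 4) :=
  le_mul_of_one_le_right (by positivity) (Real.one_le_exp (by positivity))

lemma integrable_pow_four : Integrable (fun x : ℝ => x ^ 4) (gaussianReal 0 1) :=
  integrable_pow_four_mul_exp.mono' (by fun_prop) (ae_of_all _ fun x => by
    rw [Real.norm_of_nonneg (by positivity)]
    exact pow_four_le x)

lemma integral_pow_four_le : ∫ x : ℝ, x ^ 4 ∂gaussianReal 0 1 ≤ gaussMoment :=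
  integral_mono integrable_pow_four integrable_pow_four_mul_exp pow_four_le

lemma memLp_sq : MemLp (fun x : ℝ => x ^ 2) 2 (gaussianReal 0 1) := by
  rw [memLp_two_iff_integrable_sq (by fun_prop)]
  refine integrable_pow_four.congr (ae_of_all _ fun x => ?_)
  simp only
  ring

lemma integrable_sq : Integrable (fun x : ℝ => x ^ 2) (gaussianReal 0 1) :=
  memLp_sq.integrable one_le_two

lemma integral_sq : ∫ x : ℝ, x ^ 2 ∂gaussianReal 0 1 = 1 := by
  have h := variance_of_integral_eq_zero (μ := gaussianReal 0 1) (X := fun x => x) (by fun_prop)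
    integral_id_gaussianReal
  rw [variance_fun_id_gaussianReal] at h
  simpa using h.symm

/-! ### Mean and variance of the thresholded square. -/

/-- The thresholded square `(|y| - t)_+²`. -/
def sqExcess (t y : ℝ) : ℝ := max (|y| - t) 0 ^ 2

@[fun_prop]
lemma continuous_sqExcess (t : ℝ) : Continuous (sqExcess t) := by
  unfold sqExcess
  fun_prop

lemma sqExcess_nonneg (t y : ℝ) : 0 ≤ sqExcess t y := sq_nonneg _

lemma sqExcess_neg (t y : ℝ) : sqExcess t (-y) = sqExcess t y := by
  simp [sqExcess]

lemma sqExcess_zero_left (y : ℝ) : sqExcess 0 y = y ^ 2 := by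
  simp [sqExcess]

lemma sqExcess_le_sq {t : ℝ} (ht : 0 ≤ t) (y : ℝ) : sqExcess t y ≤ y ^ 2 := by
  rw [← sq_abs y]
  exact pow_le_pow_left₀ (le_max_right _ _) (max_le (by linarith) (abs_nonneg y)) 2

/-- Midpoint convexity of `sqExcess t`; both lower bounds on its Gaussian mean come from this
inequality. -/
lemma two_mul_sqExcess_le (t a b : ℝ) :
    2 * sqExcess t a ≤ sqExcess t (a + b) + sqExcess t (a - b) := by
  unfold sqExcess
  have h1 : |2 * a| ≤ |a + b| + |a - b| := by
    have := abs_add_le (a + b) (a - b)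
    ring_nf at this ⊢
    linarith
  rw [abs_mul, abs_two] at h1
  set u := max (|a + b| - t) 0
  set w := max (|a - b| - t) 0
  have hu : |a + b| - t ≤ u := le_max_left _ _
  have hw : |a - b| - t ≤ w := le_max_left _ _
  have hu0 : 0 ≤ u := le_max_right _ _
  have hw0 : 0 ≤ w := le_max_right _ _
  have h2 : max (|a| - t) 0 ≤ (u + w) / 2 := max_le (by linarith) (by linarith)
  have h3 := pow_le_pow_left₀ (le_max_right (|a| - t) 0) h2 2
  nlinarith [sq_nonneg (u - w)]

/-- Factor `u² - v² = (u - v)(u + v)`: the positive part is 1-Lipschitz in its argument, and both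
`u` and `v` are at most the excess of `|h| + |x|`. -/
lemma sq_sqExcess_sub_le (t h x : ℝ) :
    (sqExcess t (h + x) - sqExcess t h) ^ 2 ≤ 4 * (x ^ 2 * sqExcess t (|h| + |x|)) := by
  unfold sqExcess
  rw [abs_of_nonneg (by positivity : 0 ≤ |h| + |x|)]
  set w := max (|h| + |x| - t) 0 with hw
  set u := max (|h + x| - t) 0 with hu
  set v := max (|h| - t) 0 with hv
  have hx := abs_nonneg x
  have h1 : |h + x| ≤ |h| + |x| := abs_add_le h x
  have h2 : |h| ≤ |h + x| + |x| := by
    have := abs_add_le (h + x) (-x)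
    simpa using this
  have hu0 : 0 ≤ u := le_max_right _ _
  have hv0 : 0 ≤ v := le_max_right _ _
  have huw : u ≤ w := max_le_max (by linarith) le_rfl
  have hvw : v ≤ w := max_le_max (by linarith) le_rfl
  have huv : u ≤ v + |x| :=
    max_le (by linarith [le_max_left (|h| - t) 0]) (by linarith)
  have hvu : v ≤ u + |x| :=
    max_le (by linarith [le_max_left (|h + x| - t) 0]) (by linarith)
  have h3 : (u - v) ^ 2 ≤ x ^ 2 := sq_le_sq' (by linarith) (by linarith) |>.trans (sq_abs x).le
  have h4 : (u + v) ^ 2 ≤ (2 * w) ^ 2 := pow_le_pow_left₀ (by linarith) (by linarith) 2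
  calc (u ^ 2 - v ^ 2) ^ 2 = (u - v) ^ 2 * (u + v) ^ 2 := by ring
    _ ≤ x ^ 2 * (2 * w) ^ 2 := mul_le_mul h3 h4 (sq_nonneg _) (sq_nonneg _)
    _ = _ := by ring

lemma memLp_sqExcess {t : ℝ} (ht : 0 ≤ t) (h : ℝ) :
    MemLp (fun x => sqExcess t (h + x)) 2 (gaussianReal 0 1) := by
  have hc : MemLp (fun _ : ℝ => 2 * h ^ 2) 2 (gaussianReal 0 1) := memLp_const _
  have hs : MemLp (fun x : ℝ => 2 * x ^ 2) 2 (gaussianReal 0 1) := memLp_sq.const_mul 2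
  have hb : MemLp (fun x : ℝ => 2 * h ^ 2 + 2 * x ^ 2) 2 (gaussianReal 0 1) := hc.add hs
  refine hb.mono' (by fun_prop) (ae_of_all _ fun x => ?_)
  rw [Real.norm_of_nonneg (sqExcess_nonneg _ _)]
  refine (sqExcess_le_sq ht _).trans ?_
  nlinarith [sq_nonneg (h - x)]

lemma integrable_sqExcess {t : ℝ} (ht : 0 ≤ t) (h : ℝ) :
    Integrable (fun x => sqExcess t (h + x)) (gaussianReal 0 1) :=
  (memLp_sqExcess ht h).integrable one_le_two

/-- The variance is at most the second moment about the constant `sqExcess t h`, to which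
`sq_sqExcess_sub_le` applies. -/
lemma variance_sqExcess_le_of_bound {t : ℝ} (ht : 0 ≤ t) (h : ℝ) {f : ℝ → ℝ}
    (hf : Integrable f (gaussianReal 0 1)) (hle : ∀ x, x ^ 2 * sqExcess t (|h| + |x|) ≤ f x) :
    Var[fun x => sqExcess t (h + x); gaussianReal 0 1] ≤ 4 * ∫ x, f x ∂gaussianReal 0 1 := by
  rw [← variance_sub_const (memLp_sqExcess ht h).1 (sqExcess t h), ← integral_const_mul]
  refine (variance_le_expectation_sq (by fun_prop)).trans ?_
  exact integral_mono ((memLp_sqExcess ht h).sub (memLp_const _)).integrable_sq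
    (hf.const_mul 4) fun x =>
      (sq_sqExcess_sub_le t h x).trans (mul_le_mul_of_nonneg_left (hle x) (by norm_num))

lemma variance_sqExcess_le {t : ℝ} (ht : 0 ≤ t) (h : ℝ) :
    Var[fun x => sqExcess t (h + x); gaussianReal 0 1] ≤ 8 * h ^ 2 + 8 * gaussMoment := by
  have hf : Integrable (fun x : ℝ => 2 * h ^ 2 * x ^ 2 + 2 * x ^ 4) (gaussianReal 0 1) :=
    (integrable_sq.const_mul _).add (integrable_pow_four.const_mul _)
  have := variance_sqExcess_le_of_bound ht h hf fun x => by
    have h1 := sqExcess_le_sq ht (|h| + |x|)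
    have h2 : (|h| + |x|) ^ 2 ≤ 2 * h ^ 2 + 2 * x ^ 2 := by
      rw [← sq_abs h, ← sq_abs x]
      nlinarith [sq_nonneg (|h| - |x|)]
    nlinarith [sq_nonneg x]
  rw [integral_add (integrable_sq.const_mul _) (integrable_pow_four.const_mul _),
    integral_const_mul, integral_const_mul, integral_sq] at this
  linarith [integral_pow_four_le]

/-- The bound vanishes unless `|x| > t/2`, and there `exp(x²/4) ≥ exp(t²/16)`; the factor
`exp(x²/4)` in `gaussMoment` pays for the exponential gain. -/
lemma variance_sqExcess_le_of_abs_le {t h : ℝ} (ht : 0 ≤ t) (hh : |h| ≤ t / 2) :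
    Var[fun x => sqExcess t (h + x); gaussianReal 0 1] ≤
      4 * (gaussMoment * Real.exp (-(t ^ 2 / 16))) := by
  have := variance_sqExcess_le_of_bound ht h
    (integrable_pow_four_mul_exp.mul_const (Real.exp (-(t ^ 2 / 16)))) fun x => by
    by_cases hx : |h| + |x| ≤ t
    · have : sqExcess t (|h| + |x|) = 0 := by
        rw [sqExcess, abs_of_nonneg (by positivity), max_eq_right (by linarith)]
        norm_num
      rw [this, mul_zero]
      positivity
    · push Not at hx
      have h1 : sqExcess t (|h| + |x|) ≤ x ^ 2 := by
        rw [sqExcess, abs_of_nonneg (by positivity), max_eq_left (by linarith), ← sq_abs x]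
        exact pow_le_pow_left₀ (by linarith) (by linarith) 2
      have h2 : t ^ 2 / 16 ≤ x ^ 2 / 4 := by
        rw [← sq_abs x]
        nlinarith
      rw [mul_assoc, ← Real.exp_add]
      have h3 : 1 ≤ Real.exp (x ^ 2 / 4 + -(t ^ 2 / 16)) := Real.one_le_exp (by linarith)
      nlinarith [sq_nonneg x, show 0 ≤ x ^ 4 by positivity]
  rwa [integral_mul_const] at this

/-- For `|h| > t/2` the condition `8 ≤ t²` gives `h² ≥ 2`, so the constant term `8 * gaussMoment` is
absorbed into a multiple of `h²`. -/
lemma variance_sqExcess_le_of_le_sq {t : ℝ} (ht : 0 ≤ t) (ht2 : 8 ≤ t ^ 2) (h : ℝ) :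
    Var[fun x => sqExcess t (h + x); gaussianReal 0 1] ≤
      4 * (gaussMoment * Real.exp (-(t ^ 2 / 16))) + (8 + 4 * gaussMoment) * h ^ 2 := by
  have hM := gaussMoment_nonneg
  rcases le_or_gt |h| (t / 2) with hh | hh
  · have := variance_sqExcess_le_of_abs_le ht hh
    nlinarith [sq_nonneg h, mul_nonneg hM (sq_nonneg h)]
  · have h1 := variance_sqExcess_le ht h
    have h2 : 2 ≤ h ^ 2 := by
      rw [← sq_abs h]
      nlinarith
    have h3 : 0 ≤ gaussMoment * Real.exp (-(t ^ 2 / 16)) := by positivity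
    nlinarith

lemma integral_gaussianReal_neg (f : ℝ → ℝ) :
    ∫ x, f (-x) ∂gaussianReal 0 1 = ∫ x, f x ∂gaussianReal 0 1 := by
  conv_rhs => rw [← neg_zero, ← gaussianReal_map_neg (μ := 0)]
  exact ((MeasurableEquiv.neg ℝ).measurableEmbedding.integral_map f).symm

lemma integral_sqExcess_symm (t h : ℝ) :
    ∫ x, sqExcess t (h - x) ∂gaussianReal 0 1 = ∫ x, sqExcess t (h + x) ∂gaussianReal 0 1 := by
  simp_rw [sub_eq_add_neg]
  exact integral_gaussianReal_neg fun x => sqExcess t (h + x)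

lemma integrable_sqExcess_sub {t : ℝ} (ht : 0 ≤ t) (h : ℝ) :
    Integrable (fun x => sqExcess t (h - x)) (gaussianReal 0 1) := by
  have := integrable_sqExcess ht h
  rw [← neg_zero, ← gaussianReal_map_neg (μ := 0)] at this
  simpa only [Function.comp_def, ← sub_eq_add_neg] using this.comp_measurable measurable_neg

/-- Jensen's inequality, by averaging midpoint convexity over `x` and `-x`. -/
lemma sqExcess_le_integral {t : ℝ} (ht : 0 ≤ t) (h : ℝ) :
    sqExcess t h ≤ ∫ x, sqExcess t (h + x) ∂gaussianReal 0 1 := by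
  have h1 : ∫ _, 2 * sqExcess t h ∂gaussianReal 0 1 ≤
      ∫ x, (sqExcess t (h + x) + sqExcess t (h - x)) ∂gaussianReal 0 1 :=
    integral_mono (integrable_const _) ((integrable_sqExcess ht h).add (integrable_sqExcess_sub ht h))
      fun x => two_mul_sqExcess_le t h x
  rw [integral_add (integrable_sqExcess ht h) (integrable_sqExcess_sub ht h),
    integral_sqExcess_symm, integral_const, probReal_univ, one_smul] at h1
  linarith

/-- The same convexity with centre `x` and increment `h`, using that `sqExcess t` is even. -/
lemma integral_sqExcess_mono {t : ℝ} (ht : 0 ≤ t) (h : ℝ) :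
    ∫ x, sqExcess t x ∂gaussianReal 0 1 ≤ ∫ x, sqExcess t (h + x) ∂gaussianReal 0 1 := by
  have h0 : Integrable (fun x => sqExcess t x) (gaussianReal 0 1) := by
    simpa using integrable_sqExcess ht 0
  have h1 : ∫ x, 2 * sqExcess t x ∂gaussianReal 0 1 ≤
      ∫ x, (sqExcess t (h + x) + sqExcess t (h - x)) ∂gaussianReal 0 1 :=
    integral_mono (h0.const_mul 2) ((integrable_sqExcess ht h).add (integrable_sqExcess_sub ht h))
      fun x => by
        have := two_mul_sqExcess_le t x h
        rwa [add_comm x h, ← sqExcess_neg t (x - h), neg_sub] at this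
  rw [integral_add (integrable_sqExcess ht h) (integrable_sqExcess_sub ht h),
    integral_sqExcess_symm, integral_const_mul] at h1
  linarith

lemma integral_sqExcess_le_one {t : ℝ} (ht : 0 ≤ t) :
    ∫ x, sqExcess t x ∂gaussianReal 0 1 ≤ 1 := by
  rw [← integral_sq]
  exact integral_mono (by simpa using integrable_sqExcess ht 0) integrable_sq
    fun x => sqExcess_le_sq ht x

lemma integral_sqExcess_zero_left (h : ℝ) :
    ∫ x, sqExcess 0 (h + x) ∂gaussianReal 0 1 = h ^ 2 + 1 := by
  have : ∀ x : ℝ, sqExcess 0 (h + x) = h ^ 2 + 2 * h * x + x ^ 2 := fun x => by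
    rw [sqExcess_zero_left]
    ring
  simp_rw [this]
  have hid : Integrable (fun x : ℝ => 2 * h * x) (gaussianReal 0 1) :=
    ((memLp_id_gaussianReal' 1 (by simp)).integrable le_rfl).const_mul _
  have hcid : Integrable (fun x : ℝ => h ^ 2 + 2 * h * x) (gaussianReal 0 1) :=
    (integrable_const _).add hid
  rw [integral_add hcid integrable_sq, integral_add (integrable_const _) hid, integral_const_mul,
    integral_id_gaussianReal, integral_sq]
  simp

/-- Large means are seen in the expectation of the thresholded square. -/
lemma sq_div_eight_le_integral_sub {t h : ℝ} (ht : 0 ≤ t) (ht2 : 8 ≤ t ^ 2) (hh : 2 * t < |h|) :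
    h ^ 2 / 8 ≤ (∫ x, sqExcess t (h + x) ∂gaussianReal 0 1) -
      ∫ x, sqExcess t x ∂gaussianReal 0 1 := by
  have h1 := sqExcess_le_integral ht h
  have h2 := integral_sqExcess_le_one ht
  have h3 : h ^ 2 / 4 ≤ sqExcess t h := by
    rw [sqExcess, max_eq_left (by linarith), ← sq_abs h]
    nlinarith
  have h4 : 8 ≤ h ^ 2 := by
    rw [← sq_abs h]
    nlinarith
  linarith

/-! ### The tests and their risks. -/

/-- Chebyshev's inequality for a centred additive statistic. -/
lemma minimaxRisk_le_of_variance_le {d : ℕ} {σ A C D : ℝ} (hσ : 0 < σ) (hA : 1 ≤ A) (hC : 0 ≤ C)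
    (hD : 1 / 2 ≤ D) {g : ℝ → ℝ} (hg : Measurable g)
    (hgL : ∀ h, MemLp (fun x => g (h + x)) 2 (gaussianReal 0 1))
    (hvar : ∀ h : Fin d → ℝ, ∑ j, Var[fun x => g (h j + x); gaussianReal 0 1] ≤
      C * (D ^ 2 + ∑ j, h j ^ 2))
    {Θ : Set (Fin d → ℝ)}
    (hΘ : ∀ θ ∈ Θ, A ^ 2 * D ≤ ∑ j, (θ j / σ) ^ 2 ∧ (∑ j, (θ j / σ) ^ 2) / 16 ≤
      ∑ j, ((∫ x, g (θ j / σ + x) ∂gaussianReal 0 1) - ∫ x, g x ∂gaussianReal 0 1)) :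
    minimaxRisk σ Θ ≤ ENNReal.ofReal (4096 * C / A ^ 2) := by
  -- Half of the least mean shift `A² D / 16` over the alternative, so that either error needs a
  -- deviation of `H`, respectively `n / 32`.
  set H := A ^ 2 * D / 32 with hH
  have hH0 : 0 < H := by positivity
  have hA2 : 1 ≤ A ^ 2 := one_le_pow₀ hA
  let T : (Fin d → ℝ) → ℝ := fun y => ∑ j, (g (y j / σ) - ∫ x, g x ∂gaussianReal 0 1)
  have hT : Measurable T := by
    simp only [T]
    fun_prop
  have hset : MeasurableSet {y | H < T y} := measurableSet_lt measurable_const hT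
  classical
  let Δ : (Fin d → ℝ) → Fin 2 := fun y => if H < T y then 1 else 0
  have hΔ : Measurable Δ := Measurable.ite hset measurable_const measurable_const
  have hΔ0 : MeasurableSet {y | Δ y = 0} := hΔ (measurableSet_singleton 0)
  have hΔ1 : MeasurableSet {y | Δ y = 1} := hΔ (measurableSet_singleton 1)
  let X : (Fin d → ℝ) → (Fin d → ℝ) → ℝ := fun h => ∑ j, fun ξ => g (h j + ξ j)
  have hXL : ∀ h, MemLp (X h) 2 (stdLaw d) := fun h =>
    memLp_finsetSum' _ fun j _ =>
      (hgL (h j)).comp_measurePreserving (measurePreserving_eval _ j)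
  have hXE : ∀ h, ∫ ξ, X h ξ ∂stdLaw d = ∑ j, ∫ x, g (h j + x) ∂gaussianReal 0 1 := by
    intro h
    simp only [X, Finset.sum_apply]
    rw [integral_finsetSum]
    · refine Finset.sum_congr rfl fun j _ => ?_
      exact integral_comp_eval (μ := fun _ : Fin d => gaussianReal 0 1) (i := j)
        (f := fun x => g (h j + x)) (hgL (h j)).1
    · exact fun j _ => ((hgL (h j)).comp_measurePreserving
        (measurePreserving_eval (fun _ : Fin d => gaussianReal 0 1) j)).integrable one_le_two
  have hcheb : ∀ h : Fin d → ℝ, ∀ c : ℝ, 0 < c →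
      stdLaw d {ξ | c ≤ |X h ξ - ∫ ξ, X h ξ ∂stdLaw d|} ≤
        ENNReal.ofReal (C * (D ^ 2 + ∑ j, h j ^ 2) / c ^ 2) := by
    intro h c hc
    refine (meas_ge_le_variance_div_sq (hXL h) hc).trans (ENNReal.ofReal_le_ofReal ?_)
    gcongr
    refine le_trans (le_of_eq ?_) (hvar h)
    exact variance_sum_pi (X := fun j x => g (h j + x)) fun j => hgL (h j)
  have hTX : ∀ (θ ξ : Fin d → ℝ), T (fun j => σ * (θ j / σ + ξ j)) =
      X (fun j => θ j / σ) ξ - ∑ _j : Fin d, ∫ x, g x ∂gaussianReal 0 1 := by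
    intro θ ξ
    simp only [T, X, Finset.sum_apply, Finset.sum_sub_distrib]
    congr 1
    refine Finset.sum_congr rfl fun j _ => ?_
    rw [mul_div_cancel_left₀ _ hσ.ne']
  have htype1 : obsLaw σ 0 {y | Δ y = 1} ≤ ENNReal.ofReal (1024 * C / A ^ 2) := by
    rw [obsLaw_apply hσ _ hΔ1]
    refine le_trans (measure_mono fun ξ hξ => ?_)
      ((hcheb (fun _ => 0) H hH0).trans (ENNReal.ofReal_le_ofReal ?_))
    · simp only [Set.mem_ofPred_eq, Δ] at hξ ⊢
      have hξ' : H < T (fun j => σ * ((0 : Fin d → ℝ) j / σ + ξ j)) := by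
        by_contra h
        rw [if_neg h] at hξ
        exact absurd hξ (by decide)
      rw [hTX] at hξ'
      simp only [Pi.zero_apply, zero_div] at hξ'
      rw [hXE]
      simp only [zero_add]
      exact hξ'.le.trans (le_abs_self _)
    · have : C * (D ^ 2 + ∑ _j : Fin d, (0 : ℝ) ^ 2) / H ^ 2 = 1024 * C / A ^ 2 / A ^ 2 := by
        rw [hH]
        simp
        field_simp
        norm_num
      rw [this]
      exact div_le_self (by positivity) hA2
  have htype2 : ⨆ θ ∈ Θ, obsLaw σ θ {y | Δ y = 0} ≤ ENNReal.ofReal (3072 * C / A ^ 2) := by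
    refine iSup₂_le fun θ hθ => ?_
    obtain ⟨hθ1, hθ2⟩ := hΘ θ hθ
    set n := ∑ j, (θ j / σ) ^ 2 with hn
    have hn0 : 0 < n := lt_of_lt_of_le (by positivity) hθ1
    rw [obsLaw_apply hσ _ hΔ0]
    refine le_trans (measure_mono fun ξ hξ => ?_)
      ((hcheb (fun j => θ j / σ) (n / 32) (by positivity)).trans (ENNReal.ofReal_le_ofReal ?_))
    · simp only [Set.mem_ofPred_eq, Δ] at hξ ⊢
      have hξ' : T (fun j => σ * (θ j / σ + ξ j)) ≤ H := by
        by_contra h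
        rw [if_pos (not_le.1 h)] at hξ
        exact absurd hξ (by decide)
      rw [hTX] at hξ'
      rw [Finset.sum_sub_distrib] at hθ2
      rw [hXE, abs_sub_comm]
      refine le_trans ?_ (le_abs_self _)
      linarith
    · rw [← hn, div_le_div_iff₀ (by positivity) (by positivity)]
      -- `n ≥ A² D` controls `D²`, and `D ≥ 1/2` gives `A² ≤ 2n`, which controls the variance term
      -- linear in `n`.
      have h1 : A ^ 2 * (D ^ 2 + n) ≤ 3 * n ^ 2 := by
        have h2 : A ^ 2 * D ^ 2 ≤ n ^ 2 := by
          have : A ^ 2 * D ^ 2 ≤ (A ^ 2 * D) ^ 2 := by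
            have : 0 ≤ A ^ 2 * D ^ 2 * (A ^ 2 - 1) := by
              have : 0 ≤ A ^ 2 - 1 := by linarith
              positivity
            nlinarith
          exact this.trans (pow_le_pow_left₀ (by positivity) hθ1 2)
        have h3 : A ^ 2 * n ≤ 2 * n ^ 2 := by
          have : A ^ 2 ≤ 2 * n := by nlinarith
          nlinarith
        linarith
      nlinarith
  calc minimaxRisk σ Θ ≤ testRisk σ Θ Δ := iInf₂_le Δ hΔ
    _ ≤ ENNReal.ofReal (1024 * C / A ^ 2) + ENNReal.ofReal (3072 * C / A ^ 2) :=
        add_le_add htype1 htype2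
    _ = ENNReal.ofReal (4096 * C / A ^ 2) := by
        rw [← ENNReal.ofReal_add (by positivity) (by positivity)]
        congr 1
        ring

/-- The constant in the variance bound for the test statistics. -/
noncomputable def varConst : ℝ := 16 * gaussMoment + 8

lemma varConst_pos : 0 < varConst := by
  have := gaussMoment_nonneg
  unfold varConst
  positivity

lemma minimaxRisk_le_of_dense {d : ℕ} {σ A : ℝ} (hd : 1 ≤ d) (hσ : 0 < σ) (hA : 1 ≤ A)
    {Θ : Set (Fin d → ℝ)} (hΘ : ∀ θ ∈ Θ, A ^ 2 * (σ ^ 2 * √d) ≤ ∑ j, θ j ^ 2) :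
    minimaxRisk σ Θ ≤ ENNReal.ofReal (4096 * varConst / A ^ 2) := by
  have hM := gaussMoment_nonneg
  have hd1 : (1 : ℝ) ≤ √d := Real.one_le_sqrt.2 (by exact_mod_cast hd)
  refine minimaxRisk_le_of_variance_le hσ hA varConst_pos.le (D := √d) (by linarith)
    (continuous_sqExcess 0).measurable (memLp_sqExcess le_rfl) (fun h => ?_) fun θ hθ => ⟨?_, ?_⟩
  · refine (Finset.sum_le_sum fun j _ => variance_sqExcess_le le_rfl (h j)).trans ?_
    rw [Finset.sum_add_distrib, ← Finset.mul_sum, Real.sq_sqrt (by positivity), varConst]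
    have hS : 0 ≤ ∑ j, h j ^ 2 := Finset.sum_nonneg fun _ _ => sq_nonneg _
    simp only [Finset.sum_const, Finset.card_univ, Fintype.card_fin, nsmul_eq_mul]
    have hd0 : (0 : ℝ) ≤ d := by positivity
    nlinarith [mul_nonneg hM hS, mul_nonneg hM hd0]
  · simp_rw [div_pow]
    rw [← Finset.sum_div, le_div_iff₀ (by positivity)]
    linarith [hΘ θ hθ]
  · have h0 := integral_sqExcess_zero_left 0
    simp only [zero_add] at h0
    simp_rw [integral_sqExcess_zero_left, h0]
    have : ∑ j, ((θ j / σ) ^ 2 + 1 - (0 ^ 2 + 1)) = ∑ j, (θ j / σ) ^ 2 :=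
      Finset.sum_congr rfl fun j _ => by ring
    rw [this]
    have hS : 0 ≤ ∑ j, (θ j / σ) ^ 2 := Finset.sum_nonneg fun _ _ => sq_nonneg _
    linarith

/-- Since `A² ≥ 256`, coordinates below `2t = 8√L` hold at most half of the energy; the others are
detected with weight `1/8`, which gives the required `1/16`. -/
lemma minimaxRisk_le_of_sparse {d s : ℕ} {σ A L : ℝ} (hs : 1 ≤ s) (hsd : s ^ 2 ≤ d) (hσ : 0 < σ)
    (hA : 16 ≤ A) (hL : L = Real.log (1 + d / (s : ℝ) ^ 2)) {Θ : Set (Fin d → ℝ)}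
    (hΘ : ∀ θ ∈ Θ, A ^ 2 * (σ ^ 2 * s * L) ≤ ∑ j, θ j ^ 2 ∧
      ∑ j, (if |θ j / σ| ≤ 8 * √L then (θ j / σ) ^ 2 else 0) ≤ 128 * (s * L)) :
    minimaxRisk σ Θ ≤ ENNReal.ofReal (4096 * varConst / A ^ 2) := by
  have hM := gaussMoment_nonneg
  have hL2 : 1 / 2 ≤ L := hL ▸ half_le_log_of_sq_le hs hsd
  have hs1 : (1 : ℝ) ≤ s := by exact_mod_cast hs
  have hsd' : (s : ℝ) ^ 2 ≤ d := by exact_mod_cast hsd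
  have hd0 : (0 : ℝ) < d := by nlinarith
  set t := 4 * √L with ht
  have ht0 : 0 ≤ t := by positivity
  have htL : t ^ 2 = 16 * L := by
    rw [ht, mul_pow, Real.sq_sqrt (by linarith)]
    norm_num
  have ht2 : 8 ≤ t ^ 2 := by linarith
  -- With `t²/16 = L` the left side is `d / (1 + d/s²)`.
  have hexp : d * Real.exp (-(t ^ 2 / 16)) ≤ (s : ℝ) ^ 2 := by
    have h1 : t ^ 2 / 16 = L := by linarith
    rw [h1, Real.exp_neg, hL, Real.exp_log (by positivity), mul_inv_le_iff₀ (by positivity)]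
    have : (s : ℝ) ^ 2 * (1 + d / (s : ℝ) ^ 2) = (s : ℝ) ^ 2 + d := by
      field_simp
    nlinarith
  refine minimaxRisk_le_of_variance_le hσ (by linarith) varConst_pos.le (D := s * L)
    (by nlinarith) (continuous_sqExcess t).measurable (memLp_sqExcess ht0) (fun h => ?_)
    fun θ hθ => ?_
  · refine (Finset.sum_le_sum fun j _ => variance_sqExcess_le_of_le_sq ht0 ht2 (h j)).trans ?_
    rw [Finset.sum_add_distrib, Finset.sum_const, ← Finset.mul_sum, varConst]
    have hS : 0 ≤ ∑ j, h j ^ 2 := Finset.sum_nonneg fun _ _ => sq_nonneg _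
    simp only [Finset.card_univ, Fintype.card_fin, nsmul_eq_mul]
    have h1 : (d : ℝ) * (4 * (gaussMoment * Real.exp (-(t ^ 2 / 16)))) ≤
        4 * gaussMoment * (s : ℝ) ^ 2 := by
      calc _ = 4 * gaussMoment * (d * Real.exp (-(t ^ 2 / 16))) := by ring
        _ ≤ _ := by gcongr
    have h2 : (s : ℝ) ^ 2 ≤ 4 * (s * L) ^ 2 := by
      have : 1 ≤ 4 * L ^ 2 := by nlinarith
      rw [mul_pow]
      nlinarith [sq_nonneg (s : ℝ)]
    have h3 : 4 * gaussMoment * (s : ℝ) ^ 2 ≤ 4 * gaussMoment * (4 * (s * L) ^ 2) := by gcongr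
    nlinarith [mul_nonneg hM hS, sq_nonneg (s * L)]
  · obtain ⟨h1, h2⟩ := hΘ θ hθ
    have hn : A ^ 2 * (s * L) ≤ ∑ j, (θ j / σ) ^ 2 := by
      simp_rw [div_pow]
      rw [← Finset.sum_div, le_div_iff₀ (by positivity)]
      linarith
    refine ⟨hn, ?_⟩
    have h3 : ∀ j, ((θ j / σ) ^ 2 - if |θ j / σ| ≤ 8 * √L then (θ j / σ) ^ 2 else 0) / 8 ≤
        (∫ x, sqExcess t (θ j / σ + x) ∂gaussianReal 0 1) -
          ∫ x, sqExcess t x ∂gaussianReal 0 1 := by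
      intro j
      split_ifs with hj
      · linarith [integral_sqExcess_mono ht0 (θ j / σ)]
      · rw [sub_zero]
        exact sq_div_eight_le_integral_sub ht0 ht2 (by linarith)
    refine le_trans ?_ (Finset.sum_le_sum fun j _ => h3 j)
    rw [← Finset.sum_div, Finset.sum_sub_distrib]
    have h4 : 256 * (s * L) ≤ A ^ 2 * (s * L) := by
      have : (256 : ℝ) ≤ A ^ 2 := by nlinarith
      gcongr
    linarith

lemma ofReal_varConst_div_le {A ε : ℝ} (hε : 0 < ε) (hA : 16 + 4096 * varConst / ε < A) :
    ENNReal.ofReal (4096 * varConst / A ^ 2) ≤ ENNReal.ofReal ε := by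
  have hC := varConst_pos
  have h0 : 0 < 4096 * varConst / ε := by positivity
  refine ENNReal.ofReal_le_ofReal ?_
  rw [div_le_iff₀ (by nlinarith)]
  have h1 : 4096 * varConst / ε ≤ A ^ 2 := by nlinarith
  rw [div_le_iff₀ hε] at h1
  linarith

lemma minimaxRisk_empty {d : ℕ} (σ : ℝ) : minimaxRisk σ (∅ : Set (Fin d → ℝ)) = 0 := by
  refine le_antisymm ((iInf₂_le (fun _ => 0) measurable_const).trans ?_) zero_le
  simp [testRisk]

/-! ### Energy of the small coordinates in each class. -/

lemma mul_le_sum_sq_of_le_l2 {d : ℕ} {θ : Fin d → ℝ} {A ψ : ℝ} (hA : 0 ≤ A) (hψ : 0 ≤ ψ)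
    (h : A * √ψ ≤ l2 θ) : A ^ 2 * ψ ≤ ∑ j, θ j ^ 2 := by
  rw [← l2_sq, ← Real.sq_sqrt hψ, ← mul_pow]
  exact pow_le_pow_left₀ (by positivity) h 2

lemma sum_small_le_of_l0_le {d s : ℕ} {σ L : ℝ} (hL : 0 ≤ L) {θ : Fin d → ℝ} (h : l0 θ ≤ s) :
    ∑ j, (if |θ j / σ| ≤ 8 * √L then (θ j / σ) ^ 2 else 0) ≤ 64 * (s * L) := by
  have h1 : ∀ j, (if |θ j / σ| ≤ 8 * √L then (θ j / σ) ^ 2 else 0) ≤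
      if θ j ≠ 0 then 64 * L else 0 := by
    intro j
    by_cases hj : θ j = 0
    · simp [hj]
    · rw [if_pos hj]
      split_ifs with h2
      · have := pow_le_pow_left₀ (abs_nonneg _) h2 2
        rw [sq_abs, mul_pow, Real.sq_sqrt hL] at this
        linarith
      · positivity
  refine (Finset.sum_le_sum fun j _ => h1 j).trans ?_
  rw [← Finset.sum_filter, Finset.sum_const, nsmul_eq_mul]
  have h2 : ((Finset.univ.filter fun j => θ j ≠ 0).card : ℝ) ≤ s := by
    rw [l0, Set.ncard_eq_toFinset_card'] at h
    simpa [Set.toFinset_ofPred] using (Nat.cast_le (α := ℝ)).2 h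
  nlinarith

lemma sum_abs_rpow_le {d : ℕ} {q r : ℝ} (hq : 0 < q) {θ : Fin d → ℝ} (h : lq q θ ≤ r) :
    ∑ j, |θ j| ^ q ≤ r ^ q := by
  have h0 : 0 ≤ ∑ j, |θ j| ^ q := Finset.sum_nonneg fun _ _ => by positivity
  have := Real.rpow_le_rpow (by unfold lq; positivity) h hq.le
  rwa [lq, ← Real.rpow_mul h0, one_div_mul_cancel hq.ne', Real.rpow_one] at this

/-- Failure at `m + 1` gives `(r/σ)^q ≤ L^(q/2) (m + 1) ≤ 2 m L^(q/2)`, and each small coordinate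
satisfies `x² ≤ (8√L)^(2-q) |x|^q`; the powers of `L` combine to `L`. -/
lemma sum_small_le_of_lq_le {d m : ℕ} {q r σ L : ℝ} (hq : 0 < q) (hq2 : q < 2) (hσ : 0 < σ)
    (hr : 0 < r) (hm : 1 ≤ m) (hL : L = Real.log (1 + d / (m : ℝ) ^ 2)) (hL0 : 0 < L)
    (hfail : r ^ 2 * ((m + 1 : ℕ) : ℝ) ^ (-2 / q) <
      σ ^ 2 * Real.log (1 + d / ((m + 1 : ℕ) : ℝ) ^ 2))
    {θ : Fin d → ℝ} (h : lq q θ ≤ r) :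
    ∑ j, (if |θ j / σ| ≤ 8 * √L then (θ j / σ) ^ 2 else 0) ≤ 128 * (m * L) := by
  have hm1 : (1 : ℝ) ≤ m := by exact_mod_cast hm
  have hsum : ∑ j, |θ j / σ| ^ q ≤ (r / σ) ^ q := by
    simp_rw [abs_div, abs_of_pos hσ, Real.div_rpow (abs_nonneg _) hσ.le]
    rw [← Finset.sum_div, Real.div_rpow hr.le hσ.le]
    gcongr
    exact sum_abs_rpow_le hq h
  have hr2 : (r / σ) ^ 2 ≤ L * ((m + 1 : ℕ) : ℝ) ^ (2 / q) := by
    have hlog : Real.log (1 + d / ((m + 1 : ℕ) : ℝ) ^ 2) ≤ L := by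
      rw [hL]
      refine Real.log_le_log (by positivity) ?_
      gcongr
      simp
    rw [show -2 / q = -(2 / q) by ring, Real.rpow_neg (by positivity), ← div_eq_mul_inv,
      div_lt_iff₀ (by positivity)] at hfail
    rw [div_pow, div_le_iff₀ (by positivity)]
    refine hfail.le.trans ?_
    have : 0 ≤ ((m + 1 : ℕ) : ℝ) ^ (2 / q) := by positivity
    have h2 := mul_le_mul_of_nonneg_left hlog (mul_nonneg (sq_nonneg σ) this)
    linarith
  have hrq : (r / σ) ^ q ≤ L ^ (q / 2) * (2 * m) := by
    have h1 := Real.rpow_le_rpow (by positivity) hr2 (by positivity : 0 ≤ q / 2)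
    rw [Real.mul_rpow hL0.le (by positivity), ← Real.rpow_mul (by positivity),
      div_mul_div_cancel₀ hq.ne', div_self two_ne_zero, Real.rpow_one, ← Real.rpow_natCast,
      ← Real.rpow_mul (by positivity)] at h1
    have h2 : ((2 : ℕ) : ℝ) * (q / 2) = q := by
      push_cast
      ring
    rw [h2] at h1
    refine h1.trans ?_
    gcongr
    push_cast
    linarith
  have hterm : ∀ j, (if |θ j / σ| ≤ 8 * √L then (θ j / σ) ^ 2 else 0) ≤
      (8 * √L) ^ (2 - q) * |θ j / σ| ^ q := by
    intro j
    split_ifs with hj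
    · rcases (abs_nonneg (θ j / σ)).eq_or_lt with h0 | h0
      · rw [← sq_abs, ← h0]
        simp only [ne_eq, OfNat.ofNat_ne_zero, not_false_eq_true, zero_pow]
        positivity
      · have : (θ j / σ) ^ 2 = |θ j / σ| ^ (2 - q) * |θ j / σ| ^ q := by
          rw [← Real.rpow_add h0, sub_add_cancel, ← sq_abs]
          norm_cast
        rw [this]
        gcongr
    · positivity
  have hLq : √L ^ (2 - q) * L ^ (q / 2) = L := by
    rw [Real.sqrt_eq_rpow, ← Real.rpow_mul hL0.le, ← Real.rpow_add hL0]
    convert Real.rpow_one L using 2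
    ring
  have h8 : (8 : ℝ) ^ (2 - q) ≤ 64 := by
    calc (8 : ℝ) ^ (2 - q) ≤ 8 ^ (2 : ℝ) :=
          Real.rpow_le_rpow_of_exponent_le (by norm_num) (by linarith)
      _ = 64 := by norm_num
  calc ∑ j, (if |θ j / σ| ≤ 8 * √L then (θ j / σ) ^ 2 else 0)
      ≤ ∑ j, (8 * √L) ^ (2 - q) * |θ j / σ| ^ q := Finset.sum_le_sum fun j _ => hterm j
    _ = (8 * √L) ^ (2 - q) * ∑ j, |θ j / σ| ^ q := by rw [Finset.mul_sum]
    _ ≤ (8 * √L) ^ (2 - q) * (L ^ (q / 2) * (2 * m)) := by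
        gcongr
        exact hsum.trans hrq
    _ = 8 ^ (2 - q) * (√L ^ (2 - q) * L ^ (q / 2)) * (2 * m) := by
        rw [Real.mul_rpow (by norm_num) (by positivity)]
        ring
    _ ≤ 64 * L * (2 * m) := by
        rw [hLq]
        gcongr
    _ = 128 * (m * L) := by ring

/-- For `q ≤ 2` the Euclidean norm is at most the `ℓ_q` norm. -/
lemma l2_le_of_lq_le {d : ℕ} {q r : ℝ} (hq : 0 < q) (hq2 : q ≤ 2) (hr : 0 < r) {θ : Fin d → ℝ}
    (h : lq q θ ≤ r) : l2 θ ≤ r := by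
  have hsum := sum_abs_rpow_le hq h
  have hj : ∀ j, |θ j| ≤ r := by
    intro j
    have h1 : |θ j| ^ q ≤ r ^ q :=
      (Finset.single_le_sum (f := fun j => |θ j| ^ q) (fun _ _ => by positivity)
        (Finset.mem_univ j)).trans hsum
    exact (Real.rpow_le_rpow_iff (abs_nonneg _) hr.le hq).1 h1
  refine Real.sqrt_le_iff.2 ⟨hr.le, ?_⟩
  have hterm : ∀ j, θ j ^ 2 ≤ r ^ (2 - q) * |θ j| ^ q := by
    intro j
    rcases (abs_nonneg (θ j)).eq_or_lt with h0 | h0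
    · rw [← sq_abs, ← h0]
      simp only [ne_eq, OfNat.ofNat_ne_zero, not_false_eq_true, zero_pow]
      positivity
    · have : θ j ^ 2 = |θ j| ^ (2 - q) * |θ j| ^ q := by
        rw [← Real.rpow_add h0, sub_add_cancel, ← sq_abs]
        norm_cast
      rw [this]
      gcongr
      exact hj j
  calc ∑ j, θ j ^ 2 ≤ ∑ j, r ^ (2 - q) * |θ j| ^ q := Finset.sum_le_sum fun j _ => hterm j
    _ = r ^ (2 - q) * ∑ j, |θ j| ^ q := by rw [Finset.mul_sum]
    _ ≤ r ^ (2 - q) * r ^ q := by gcongr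
    _ = r ^ 2 := by
        rw [← Real.rpow_add hr, sub_add_cancel]
        norm_cast

/-! ### Effective sparsity and the zones of the rate. -/

lemma natCast_le_effSparsity_iff {d s : ℕ} {q r σ : ℝ} (hs : 1 ≤ s) :
    (s : ℕ∞) ≤ effSparsity d q r σ ↔ ∀ t : ℕ, 1 ≤ t → t ≤ s →
      σ ^ 2 * Real.log (1 + d / (t : ℝ) ^ 2) ≤ r ^ 2 * (t : ℝ) ^ (-2 / q) := by
  constructor
  · intro h
    by_contra hcon
    have hle : effSparsity d q r σ ≤ ((s - 1 : ℕ) : ℕ∞) := by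
      refine iSup₂_le fun s' hs' => ?_
      have : s' < s := by
        by_contra hlt
        exact hcon fun t h1 h2 => hs'.2 t h1 (h2.trans (not_lt.1 hlt))
      exact_mod_cast Nat.le_sub_one_of_lt this
    have : s ≤ s - 1 := by exact_mod_cast h.trans hle
    omega
  · intro h
    exact le_iSup₂_of_le (f := fun (s : ℕ) _ => (s : ℕ∞)) s ⟨hs, h⟩ le_rfl

lemma one_le_natSqrt {d : ℕ} (hd : 1 ≤ d) : 1 ≤ Nat.sqrt d :=
  Nat.le_sqrt.2 (by simpa using hd)

/-- The three zones of the rate on `ℓ_q` balls. -/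
lemma psiBall_cases {d : ℕ} {q r σ : ℝ} (hd : 1 ≤ d) :
    (psiBall d q r σ = σ ^ 2 * √d ∧ σ ^ 2 * Real.log (1 + d / (Nat.sqrt d : ℝ) ^ 2) ≤
        r ^ 2 * (Nat.sqrt d : ℝ) ^ (-2 / q)) ∨
      (∃ m : ℕ, 1 ≤ m ∧ m ^ 2 ≤ d ∧
        psiBall d q r σ = σ ^ 2 * m * Real.log (1 + d / (m : ℝ) ^ 2) ∧
        σ ^ 2 * Real.log (1 + d / (m : ℝ) ^ 2) ≤ r ^ 2 * (m : ℝ) ^ (-2 / q) ∧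
        r ^ 2 * ((m + 1 : ℕ) : ℝ) ^ (-2 / q) <
          σ ^ 2 * Real.log (1 + d / ((m + 1 : ℕ) : ℝ) ^ 2)) ∨
      (psiBall d q r σ = r ^ 2 ∧ r ^ 2 ≤ σ ^ 2 * Real.log (1 + d)) := by
  by_cases h1 : effSparsity d q r σ = ⊤ ∨ √d < ((effSparsity d q r σ).toNat : ℝ)
  · left
    refine ⟨by simp only [psiBall, if_pos h1], ?_⟩
    -- As `⌊√d⌋ ≤ m`, the defining inequality holds at `⌊√d⌋`; the lower bound in the dense zone
    -- needs nothing more.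
    have hle : (Nat.sqrt d : ℕ∞) ≤ effSparsity d q r σ := by
      rcases h1 with h1 | h1
      · simp [h1]
      · refine le_trans ?_ (ENat.natCast_toNat_le_self _)
        exact_mod_cast Real.nat_sqrt_le_real_sqrt.trans h1.le
    exact (natCast_le_effSparsity_iff (one_le_natSqrt hd)).1 hle _ (one_le_natSqrt hd) le_rfl
  right
  have htop : effSparsity d q r σ ≠ ⊤ := fun h => h1 (Or.inl h)
  have hsqrt : ((effSparsity d q r σ).toNat : ℝ) ≤ √d := not_lt.1 fun h => h1 (Or.inr h)
  obtain ⟨m, hm⟩ := ENat.ne_top_iff_exists.1 htop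
  by_cases h2 : 1 ≤ effSparsity d q r σ
  · left
    have hψ : psiBall d q r σ = σ ^ 2 * (effSparsity d q r σ).toNat *
        Real.log (1 + d / ((effSparsity d q r σ).toNat : ℝ) ^ 2) := by
      simp only [psiBall, if_neg h1, if_pos h2]
    rw [← hm, ENat.toNat_natCast] at hsqrt hψ
    have hm1 : 1 ≤ m := by
      rw [← hm] at h2
      exact_mod_cast h2
    refine ⟨m, hm1, ?_, hψ, ?_, ?_⟩
    · have := pow_le_pow_left₀ (by positivity) hsqrt 2
      rw [Real.sq_sqrt (by positivity)] at this
      exact_mod_cast this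
    · exact (natCast_le_effSparsity_iff hm1).1 hm.le m hm1 le_rfl
    · by_contra hcon
      have : ((m + 1 : ℕ) : ℕ∞) ≤ effSparsity d q r σ := by
        refine (natCast_le_effSparsity_iff (by omega)).2 fun t ht1 ht2 => ?_
        rcases Nat.lt_or_ge m t with hlt | hge
        · obtain rfl : t = m + 1 := by omega
          exact not_lt.1 hcon
        · exact (natCast_le_effSparsity_iff hm1).1 hm.le t ht1 hge
      rw [← hm] at this
      have : m + 1 ≤ m := by exact_mod_cast this
      omega
  · right
    refine ⟨by simp only [psiBall, if_neg h1, if_neg h2], ?_⟩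
    by_contra hcon
    refine h2 ?_
    have := (natCast_le_effSparsity_iff (d := d) (q := q) (r := r) (σ := σ) le_rfl).2
      fun t ht1 ht2 => by
        obtain rfl : t = 1 := by omega
        simpa using (not_le.1 hcon).le
    exact_mod_cast this

/-! ### Spikes inside the ball and comparison of the rates. -/

lemma rpow_mul_sqrt_le {s : ℕ} {q r σ L : ℝ} (hs : 1 ≤ s) (hr : 0 < r) (hL : 0 ≤ L)
    (h : σ ^ 2 * L ≤ r ^ 2 * (s : ℝ) ^ (-2 / q)) : (s : ℝ) ^ (1 / q) * (σ * √L) ≤ r := by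
  have hs0 : (0 : ℝ) < s := by exact_mod_cast hs
  refine le_of_sq_le_sq ?_ hr.le
  have h1 : ((s : ℝ) ^ (1 / q)) ^ 2 = (s : ℝ) ^ (2 / q) := by
    rw [← Real.rpow_natCast, ← Real.rpow_mul hs0.le]
    congr 1
    push_cast
    ring
  rw [mul_pow, mul_pow, Real.sq_sqrt hL, h1]
  calc (s : ℝ) ^ (2 / q) * (σ ^ 2 * L) ≤ (s : ℝ) ^ (2 / q) * (r ^ 2 * (s : ℝ) ^ (-2 / q)) := by
        gcongr
    _ = r ^ 2 * ((s : ℝ) ^ (2 / q) * (s : ℝ) ^ (-2 / q)) := by ring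
    _ = r ^ 2 := by
        rw [← Real.rpow_add hs0, ← add_div]
        simp

lemma sqrt_le_two_mul_natSqrt {d : ℕ} (hd : 1 ≤ d) : √d ≤ 2 * Nat.sqrt d := by
  have h1 : √d ≤ (Nat.sqrt d : ℝ) + 1 := Real.real_sqrt_le_nat_sqrt_succ
  have h2 : (1 : ℝ) ≤ Nat.sqrt d := by exact_mod_cast one_le_natSqrt hd
  linarith

/-- At `⌊√d⌋` the logarithm is at least `1/2` and `√d ≤ 2⌊√d⌋`, so the dense rate is within a factor
`4` of the sparse formula there. -/
lemma sq_mul_sqrt_le {d : ℕ} (hd : 1 ≤ d) (σ : ℝ) :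
    σ ^ 2 * √d ≤ 4 * (σ ^ 2 * Nat.sqrt d * Real.log (1 + d / (Nat.sqrt d : ℝ) ^ 2)) := by
  have h1 := sqrt_le_two_mul_natSqrt hd
  have h2 := half_le_log_of_sq_le (one_le_natSqrt hd) (Nat.sqrt_le' d)
  have h3 : (0 : ℝ) ≤ Nat.sqrt d := by positivity
  have h4 : √d ≤ 4 * (Nat.sqrt d * Real.log (1 + d / (Nat.sqrt d : ℝ) ^ 2)) := by nlinarith
  nlinarith [sq_nonneg σ]

lemma psiSparse_pos {d s : ℕ} {σ : ℝ} (hs : 1 ≤ s) (hsd : s ≤ d) (hσ : 0 < σ) :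
    0 < psiSparse d s σ := by
  have hs0 : (0 : ℝ) < s := by exact_mod_cast hs
  have hd0 : (0 : ℝ) < d := by exact_mod_cast (hs.trans hsd)
  unfold psiSparse
  split_ifs
  · have : 0 < Real.log (1 + d / (s : ℝ) ^ 2) :=
      Real.log_pos (lt_add_of_pos_right _ (by positivity))
    positivity
  · positivity

lemma psiBall_pos {d : ℕ} {q r σ : ℝ} (hd : 1 ≤ d) (hr : 0 < r) (hσ : 0 < σ) :
    0 < psiBall d q r σ := by
  have hd0 : (0 : ℝ) < d := by exact_mod_cast hd
  rcases psiBall_cases (q := q) (r := r) (σ := σ) hd with ⟨h, -⟩ | ⟨m, hm, hmd, h, -⟩ | ⟨h, -⟩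
  · rw [h]
    positivity
  · have := half_le_log_of_sq_le hm hmd
    have hm0 : (0 : ℝ) < m := by exact_mod_cast hm
    rw [h]
    positivity
  · rw [h]
    positivity

lemma sq_le_of_lt_sqrt {d s : ℕ} (h : (s : ℝ) < √d) : s ^ 2 ≤ d := by
  have := pow_le_pow_left₀ (by positivity) h.le 2
  rw [Real.sq_sqrt (by positivity)] at this
  exact_mod_cast this

/-- The factor `4` in `hψle` is paid for by spikes `2Aσ√L`, and `A < a / 2` with `a ≤ 1` keeps `4A²
≤ a`. A separate `s' ≤ s` lets the dense zone use supports of size `⌊√d⌋`. -/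
lemma le_minimaxRisk_sparseAlt {d s s' : ℕ} {σ ε a A ψ : ℝ} (hs : 1 ≤ s') (hss : s' ≤ s)
    (hsd : s' ^ 2 ≤ d) (hσ : 0 < σ) (hε : 0 < ε) (ha0 : 0 < a) (ha : a ≤ 1)
    (haε : Real.exp (2 * a) ≤ 1 + ε ^ 2) (hA : 0 < A) (hAa : A < a / 2) (hψ : 0 ≤ ψ)
    (hψle : ψ ≤ 4 * (σ ^ 2 * s' * Real.log (1 + d / (s' : ℝ) ^ 2))) :
    ENNReal.ofReal (1 - ε) ≤ minimaxRisk σ (sparseAlt d s (A * √ψ)) := by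
  have hL := half_le_log_of_sq_le hs hsd
  set L := Real.log (1 + d / (s' : ℝ) ^ 2) with hLdef
  have hτ2 : (2 * A * (σ * √L)) ^ 2 = 4 * A ^ 2 * (σ ^ 2 * L) := by
    rw [mul_pow, mul_pow, mul_pow, Real.sq_sqrt (by linarith)]
    ring
  refine le_minimaxRisk_of_card_eq (τ := 2 * A * (σ * √L)) hs hsd hσ hε ha0.le ha haε ?_
    fun S hS => ⟨(l0_ite_le S _).trans (hS.le.trans hss), le_l2_of_sq_le ?_⟩
  · rw [hτ2]
    have : 4 * A ^ 2 ≤ a := by nlinarith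
    gcongr
  · rw [sum_sq_ite, hS, hτ2, mul_pow, Real.sq_sqrt hψ]
    nlinarith [sq_nonneg A]

lemma le_minimaxRisk_ballAlt {d s : ℕ} {q r σ ε a A ψ : ℝ} (hq : 0 < q) (hr : 0 < r) (hs : 1 ≤ s)
    (hsd : s ^ 2 ≤ d) (hσ : 0 < σ) (hε : 0 < ε) (ha0 : 0 < a) (ha : a ≤ 1)
    (haε : Real.exp (2 * a) ≤ 1 + ε ^ 2) (hA : 0 < A) (hAa : A < a / 2) (hψ : 0 ≤ ψ)
    (hψle : ψ ≤ 4 * (σ ^ 2 * s * Real.log (1 + d / (s : ℝ) ^ 2)))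
    (hball : σ ^ 2 * Real.log (1 + d / (s : ℝ) ^ 2) ≤ r ^ 2 * (s : ℝ) ^ (-2 / q)) :
    ENNReal.ofReal (1 - ε) ≤ minimaxRisk σ (ballAlt d q r (A * √ψ)) := by
  have hL := half_le_log_of_sq_le hs hsd
  set L := Real.log (1 + d / (s : ℝ) ^ 2) with hLdef
  have hτ2 : (2 * A * (σ * √L)) ^ 2 = 4 * A ^ 2 * (σ ^ 2 * L) := by
    rw [mul_pow, mul_pow, mul_pow, Real.sq_sqrt (by linarith)]
    ring
  refine le_minimaxRisk_of_card_eq (τ := 2 * A * (σ * √L)) hs hsd hσ hε ha0.le ha haε ?_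
    fun S hS => ⟨?_, le_l2_of_sq_le ?_⟩
  · rw [hτ2]
    have : 4 * A ^ 2 ≤ a := by nlinarith
    gcongr
  · rw [lq_ite hq (by positivity), hS]
    -- Spikes `σ√L` already fit in the ball, and `2A ≤ 1`.
    have h1 := rpow_mul_sqrt_le hs hr (by linarith) hball
    have h2 : 0 ≤ (s : ℝ) ^ (1 / q) * (σ * √L) := by positivity
    nlinarith
  · rw [sum_sq_ite, hS, hτ2, mul_pow, Real.sq_sqrt hψ]
    nlinarith [sq_nonneg A]

lemma le_minimaxRisk_ballAlt_of_radius_le {d : ℕ} {q r σ ε a A : ℝ} (hq : 0 < q) (hr : 0 < r)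
    (hd : 1 ≤ d) (hσ : 0 < σ) (hε : 0 < ε) (ha0 : 0 < a) (ha : a ≤ 1)
    (haε : Real.exp (2 * a) ≤ 1 + ε ^ 2) (hA : 0 < A) (hAa : A < a / 2)
    (hrσ : r ^ 2 ≤ σ ^ 2 * Real.log (1 + d)) :
    ENNReal.ofReal (1 - ε) ≤ minimaxRisk σ (ballAlt d q r (A * √(r ^ 2))) := by
  rw [Real.sqrt_sq hr.le]
  refine le_minimaxRisk_of_card_eq (s := 1) (τ := A * r) le_rfl (by simpa using hd) hσ hε ha0.le ha
    haε ?_ fun S hS => ⟨?_, le_l2_of_sq_le ?_⟩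
  · simp only [Nat.cast_one, one_pow, div_one, mul_pow]
    have : A ^ 2 ≤ a := by nlinarith
    gcongr
  · rw [lq_ite hq (by positivity), hS]
    simp only [Nat.cast_one, Real.one_rpow, one_mul]
    nlinarith
  · rw [sum_sq_ite, hS]
    simp

/-! ### Uniform constants and assembly of the bounds. -/

lemma exists_forall_minimaxRisk_sparseAlt_le {ε : ℝ} (hε : 0 < ε) : ∃ Aε : ℝ, 0 < Aε ∧
    ∀ (d s : ℕ) (σ : ℝ), 1 ≤ s → s ≤ d → 0 < σ → ∀ A : ℝ, Aε < A →
      minimaxRisk σ (sparseAlt d s (A * √(psiSparse d s σ))) ≤ ENNReal.ofReal ε := by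
  have hC := varConst_pos
  have hpos : 0 < 4096 * varConst / ε := by positivity
  -- `16` meets the requirement of the sparse test; the second term makes the Chebyshev bound at
  -- most `ε`, as `A ≤ A²`.
  refine ⟨16 + 4096 * varConst / ε, by positivity, fun d s σ hs hsd hσ A hA => ?_⟩
  refine le_trans ?_ (ofReal_varConst_div_le hε hA)
  have hA16 : 16 ≤ A := by linarith
  have hψ := psiSparse_pos hs hsd hσ
  have hsum : ∀ θ ∈ sparseAlt d s (A * √(psiSparse d s σ)),
      A ^ 2 * psiSparse d s σ ≤ ∑ j, θ j ^ 2 := fun θ hθ =>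
    mul_le_sum_sq_of_le_l2 (by linarith) hψ.le hθ.2
  by_cases h : (s : ℝ) < √d
  · have hsq := sq_le_of_lt_sqrt h
    have hL := half_le_log_of_sq_le hs hsq
    refine minimaxRisk_le_of_sparse hs hsq hσ hA16 rfl fun θ hθ => ⟨?_, ?_⟩
    · have := hsum θ hθ
      rwa [psiSparse, if_pos h] at this
    · have := sum_small_le_of_l0_le (σ := σ) (by linarith) hθ.1
      refine this.trans ?_
      have : 0 ≤ (s : ℝ) * Real.log (1 + d / (s : ℝ) ^ 2) := by positivity
      linarith
  · refine minimaxRisk_le_of_dense (hs.trans hsd) hσ (by linarith) fun θ hθ => ?_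
    have := hsum θ hθ
    rwa [psiSparse, if_neg h] at this

lemma exists_forall_le_minimaxRisk_sparseAlt {ε : ℝ} (hε : 0 < ε) : ∃ aε : ℝ, 0 < aε ∧
    ∀ (d s : ℕ) (σ : ℝ), 1 ≤ s → s ≤ d → 0 < σ → ∀ A : ℝ, 0 < A → A < aε →
      ENNReal.ofReal (1 - ε) ≤ minimaxRisk σ (sparseAlt d s (A * √(psiSparse d s σ))) := by
  obtain ⟨a, ha0, ha, haε⟩ := exists_exp_two_mul_le hε
  refine ⟨a / 2, by positivity, fun d s σ hs hsd hσ A hA hAa => ?_⟩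
  have hψ := psiSparse_pos hs hsd hσ
  by_cases h : (s : ℝ) < √d
  · have hsq := sq_le_of_lt_sqrt h
    refine le_minimaxRisk_sparseAlt hs le_rfl hsq hσ hε ha0 ha haε hA hAa hψ.le ?_
    rw [psiSparse, if_pos h] at hψ ⊢
    linarith
  · have hd := hs.trans hsd
    have hle : Nat.sqrt d ≤ s := by
      exact_mod_cast Real.nat_sqrt_le_real_sqrt.trans (not_lt.1 h)
    refine le_minimaxRisk_sparseAlt (one_le_natSqrt hd) hle (Nat.sqrt_le' d) hσ hε ha0 ha haε hA hAa
      hψ.le ?_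
    rw [psiSparse, if_neg h]
    exact sq_mul_sqrt_le hd σ

lemma exists_forall_minimaxRisk_ballAlt_le {q ε : ℝ} (hq : 0 < q) (hq2 : q < 2) (hε : 0 < ε) :
    ∃ Aε : ℝ, 0 < Aε ∧ ∀ (d : ℕ) (r σ : ℝ), 1 ≤ d → 0 < r → 0 < σ → ∀ A : ℝ, Aε < A →
      minimaxRisk σ (ballAlt d q r (A * √(psiBall d q r σ))) ≤ ENNReal.ofReal ε := by
  have hC := varConst_pos
  have hpos : 0 < 4096 * varConst / ε := by positivity
  refine ⟨16 + 4096 * varConst / ε, by positivity, fun d r σ hd hr hσ A hA => ?_⟩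
  refine le_trans ?_ (ofReal_varConst_div_le hε hA)
  have hA16 : 16 ≤ A := by linarith
  have hψ := psiBall_pos (q := q) hd hr hσ
  have hsum : ∀ θ ∈ ballAlt d q r (A * √(psiBall d q r σ)),
      A ^ 2 * psiBall d q r σ ≤ ∑ j, θ j ^ 2 := fun θ hθ =>
    mul_le_sum_sq_of_le_l2 (by linarith) hψ.le hθ.2
  rcases psiBall_cases (q := q) (r := r) (σ := σ) hd with
    ⟨h, -⟩ | ⟨m, hm, hmd, h, -, hfail⟩ | ⟨h, -⟩
  · refine minimaxRisk_le_of_dense hd hσ (by linarith) fun θ hθ => ?_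
    rw [← h]
    exact hsum θ hθ
  · refine minimaxRisk_le_of_sparse hm hmd hσ hA16 rfl fun θ hθ => ⟨?_, ?_⟩
    · rw [← h]
      exact hsum θ hθ
    · have hL := half_le_log_of_sq_le hm hmd
      exact sum_small_le_of_lq_le hq hq2 hσ hr hm rfl (by linarith) hfail hθ.1
  · have : ballAlt d q r (A * √(psiBall d q r σ)) = ∅ := by
      refine Set.eq_empty_of_forall_notMem fun θ hθ => ?_
      have h1 := hθ.2
      rw [h, Real.sqrt_sq hr.le] at h1
      have h2 := l2_le_of_lq_le hq hq2.le hr hθ.1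
      nlinarith
    rw [this, minimaxRisk_empty]
    exact zero_le

lemma exists_forall_le_minimaxRisk_ballAlt {q ε : ℝ} (hq : 0 < q) (hε : 0 < ε) :
    ∃ aε : ℝ, 0 < aε ∧ ∀ (d : ℕ) (r σ : ℝ), 1 ≤ d → 0 < r → 0 < σ → ∀ A : ℝ, 0 < A → A < aε →
      ENNReal.ofReal (1 - ε) ≤ minimaxRisk σ (ballAlt d q r (A * √(psiBall d q r σ))) := by
  obtain ⟨a, ha0, ha, haε⟩ := exists_exp_two_mul_le hε
  refine ⟨a / 2, by positivity, fun d r σ hd hr hσ A hA hAa => ?_⟩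
  have hψ := psiBall_pos (q := q) hd hr hσ
  rcases psiBall_cases (q := q) (r := r) (σ := σ) hd with
    ⟨h, hball⟩ | ⟨m, hm, hmd, h, hball, -⟩ | ⟨h, hrσ⟩
  · exact le_minimaxRisk_ballAlt hq hr (one_le_natSqrt hd) (Nat.sqrt_le' d) hσ hε ha0 ha haε hA hAa
      hψ.le (h ▸ sq_mul_sqrt_le hd σ) hball
  · refine le_minimaxRisk_ballAlt hq hr hm hmd hσ hε ha0 ha haε hA hAa hψ.le ?_ hball
    rw [h] at hψ ⊢
    linarith
  · rw [h]
    exact le_minimaxRisk_ballAlt_of_radius_le hq hr hd hσ hε ha0 ha haε hA hAa hrσ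

end SparseTesting

theorem theorem10 :
    -- the classes `B_0(s)`: positivity of the rate, upper bound, lower bound
    ((∀ (d s : ℕ) (σ : ℝ), 1 ≤ s → s ≤ d → 0 < σ → 0 < √(SparseTesting.psiSparse d s σ)) ∧
      (∀ ε : ℝ, 0 < ε → ε < 1 → ∃ Aε : ℝ, 0 < Aε ∧
        ∀ (d s : ℕ) (σ : ℝ), 1 ≤ s → s ≤ d → 0 < σ → ∀ A : ℝ, Aε < A →
          SparseTesting.minimaxRisk σ
              (SparseTesting.sparseAlt d s (A * √(SparseTesting.psiSparse d s σ))) ≤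
            ENNReal.ofReal ε) ∧
      (∀ ε : ℝ, 0 < ε → ε < 1 → ∃ aε : ℝ, 0 < aε ∧
        ∀ (d s : ℕ) (σ : ℝ), 1 ≤ s → s ≤ d → 0 < σ → ∀ A : ℝ, 0 < A → A < aε →
          ENNReal.ofReal (1 - ε) ≤
            SparseTesting.minimaxRisk σ
              (SparseTesting.sparseAlt d s (A * √(SparseTesting.psiSparse d s σ))))) ∧
    -- the classes `B_q(r)`, `0 < q < 2`: the same, with constants that may depend on `q`
    (∀ q : ℝ, 0 < q → q < 2 →
      (∀ (d : ℕ) (r σ : ℝ), 1 ≤ d → 0 < r → 0 < σ → 0 < √(SparseTesting.psiBall d q r σ)) ∧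
      (∀ ε : ℝ, 0 < ε → ε < 1 → ∃ Aε : ℝ, 0 < Aε ∧
        ∀ (d : ℕ) (r σ : ℝ), 1 ≤ d → 0 < r → 0 < σ → ∀ A : ℝ, Aε < A →
          SparseTesting.minimaxRisk σ
              (SparseTesting.ballAlt d q r (A * √(SparseTesting.psiBall d q r σ))) ≤
            ENNReal.ofReal ε) ∧
      (∀ ε : ℝ, 0 < ε → ε < 1 → ∃ aε : ℝ, 0 < aε ∧
        ∀ (d : ℕ) (r σ : ℝ), 1 ≤ d → 0 < r → 0 < σ → ∀ A : ℝ, 0 < A → A < aε →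
          ENNReal.ofReal (1 - ε) ≤
            SparseTesting.minimaxRisk σ
              (SparseTesting.ballAlt d q r (A * √(SparseTesting.psiBall d q r σ))))) := by
  exact ⟨⟨fun _ _ _ hs hsd hσ => Real.sqrt_pos.2 (SparseTesting.psiSparse_pos hs hsd hσ),
      fun _ hε _ => SparseTesting.exists_forall_minimaxRisk_sparseAlt_le hε,
      fun _ hε _ => SparseTesting.exists_forall_le_minimaxRisk_sparseAlt hε⟩,
    fun _ hq hq2 => ⟨fun _ _ _ hd hr hσ => Real.sqrt_pos.2 (SparseTesting.psiBall_pos hd hr hσ),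
      fun _ hε _ => SparseTesting.exists_forall_minimaxRisk_ballAlt_le hq hq2 hε,
      fun _ hε _ => SparseTesting.exists_forall_le_minimaxRisk_ballAlt hq hε⟩⟩
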